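/- Let $\tau>0$ and let $\mathrm{SL}(2,\mathbb R)=\{(z,w)\in\mathbb C^2 : |z|^2-|w|^2=1\}\subset\mathbb R^4_2$, where $\mathbb R^4_2=\mathbb C^2=\mathbb R^4$ carries the inner product $\langle v,w\rangle=v_1w_1+v_2w_2-v_3w_3-v_4w_4$. Put $X_1(z,w)=(iz,iw)$, $X_2(z,w)=(i\bar w,i\bar z)$, $X_3(z,w)=(\bar w,\bar z)$, and let $\mathrm{SL}(2,\mathbb R)_\tau$ be $\mathrm{SL}(2,\mathbb R)$ with the Riemannian metric $$g_\tau(X,Y)=-\langle X,Y\rangle+(1+\tau^2)\langle X,X_1\rangle\langle Y,X_1\rangle ,$$ with Levi-Civita connection $\nabla$, orthonormal frame $E_1=-\tau^{-1}X_1$, $E_2=X_2$, $E_3=X_3$, and the orientation for which this frame is positive. Let $I\subset\mathbb R$ be a nonempty open interval and $\gamma:I\to\mathrm{SL}(2,\mathbb R)_\tau$ a smooth curve parametrized by arc length, with $T=\gamma'$. The curve $\gamma$ is called *biharmonic* if it is a critical point, with respect to compactly supported smooth variations, of the bienergy $E_2(c)=\frac12\int |\nabla_{c'}c'|^2\,ds$,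 and *proper biharmonic* if it is biharmonic and not a geodesic (that is, $\nabla_TT$ does not vanish identically). Let $k_1=|\nabla_TT|$ be the geodesic curvature and, where $k_1\neq0$, let $N=\nabla_TT/k_1$, let $B$ be the unit vector field such that $(T,N,B)$ is a positively oriented orthonormal frame, let $k_2=g_\tau(\nabla_TN,B)$ be the geodesic torsion, and let $N_1=g_\tau(N,E_1)$, $B_1=g_\tau(B,E_1)$. **Theorem.** The curve $\gamma$ is proper biharmonic if and only if $k_1$ is constant and nonzero on $I$ and, on all of $I$, $$k_1^2+k_2^2=\tau^2-4(1+\tau^2)B_1^2,\qquad k_2'=-4(1+\tau^2)N_1B_1 .$$ -/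

import Mathlib

open scoped ContDiff

noncomputable section

namespace SLTau

/-- The inner product of signature `(2,2)` on `ℝ⁴₂ = ℂ × ℂ`. -/
def ip (x y : ℂ × ℂ) : ℝ :=
  x.1.re * y.1.re + x.1.im * y.1.im - x.2.re * y.2.re - x.2.im * y.2.im

/-- `SL(2,ℝ)`, identified with `{(z, w) ∈ ℂ² : |z|² - |w|² = 1}`. -/
def SL2 : Set (ℂ × ℂ) := {p | ip p p = 1}

/-- The Hopf vector field `X₁`. -/
def X1 (p : ℂ × ℂ) : ℂ × ℂ := (Complex.I * p.1, Complex.I * p.2)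

/-- The horizontal vector field `X₂`. -/
def X2 (p : ℂ × ℂ) : ℂ × ℂ :=
  (Complex.I * (starRingEnd ℂ) p.2, Complex.I * (starRingEnd ℂ) p.1)

/-- The horizontal vector field `X₃`. -/
def X3 (p : ℂ × ℂ) : ℂ × ℂ := ((starRingEnd ℂ) p.2, (starRingEnd ℂ) p.1)

/-- The metric `g_τ` at the point `p`, on vectors tangent to `SL(2,ℝ)` at `p`. -/
def metric (τ : ℝ) (p X Y : ℂ × ℂ) : ℝ :=
  -ip X Y + (1 + τ ^ 2) * ip X (X1 p) * ip Y (X1 p)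

/-- The orthonormal frame `E₁ = -τ⁻¹ X₁`, `E₂ = X₂`, `E₃ = X₃`, indexed by `0, 1, 2`. -/
def frame (τ : ℝ) (i : Fin 3) (p : ℂ × ℂ) : ℂ × ℂ :=
  ![(-τ⁻¹) • X1 p, X2 p, X3 p] i

/-- The component `V_i` at `p` of a tangent vector `V` in the orthonormal frame. -/
def comp (τ : ℝ) (p V : ℂ × ℂ) (i : Fin 3) : ℝ := metric τ p V (frame τ i p)

/-- `g_τ([E_i, E_j], E_k)` at the point `p`. -/
def bracketCoeff (τ : ℝ) (p : ℂ × ℂ) (i j k : Fin 3) : ℝ :=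
  metric τ p (VectorField.lieBracket ℝ (frame τ i) (frame τ j) p) (frame τ k p)

/-- `g_τ(∇_{E_i} E_j, E_k)` at the point `p`, for the Levi-Civita connection `∇` of `g_τ`:
the Koszul formula in an orthonormal frame. -/
def connCoeff (τ : ℝ) (p : ℂ × ℂ) (i j k : Fin 3) : ℝ :=
  (bracketCoeff τ p i j k - bracketCoeff τ p j k i + bracketCoeff τ p k i j) / 2

/-- The Levi-Civita covariant derivative `∇_{c'} V` of a tangent vector field `V` along a curve
`c` in `SL(2,ℝ)`. -/
def covDeriv (τ : ℝ) (c V : ℝ → ℂ × ℂ) (s : ℝ) : ℂ × ℂ :=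
  ∑ k : Fin 3, (deriv (fun u => comp τ (c u) (V u) k) s
      + ∑ i : Fin 3, ∑ j : Fin 3,
          comp τ (c s) (deriv c s) i * comp τ (c s) (V s) j * connCoeff τ (c s) i j k)
    • frame τ k (c s)

/-- The tension field `∇_{c'} c'` of a curve `c` (not necessarily of unit speed). -/
def tension (τ : ℝ) (c : ℝ → ℂ × ℂ) (s : ℝ) : ℂ × ℂ := covDeriv τ c (deriv c) s

/-- The bienergy of the curve `c` over `[a, b]`. -/
def bienergy (τ : ℝ) (c : ℝ → ℂ × ℂ) (a b : ℝ) : ℝ :=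
  (1 / 2) * ∫ s in a..b, metric τ (c s) (tension τ c s) (tension τ c s)

/-- `Φ t`, `|t| < ε`, is a smooth variation of `γ : I → SL(2,ℝ)` through curves in `SL(2,ℝ)`,
fixed outside the compact interval `[a, b]`. -/
structure IsVariation (I : Set ℝ) (γ : ℝ → ℂ × ℂ) (a b ε : ℝ) (Φ : ℝ → ℝ → ℂ × ℂ) : Prop where
  smooth : ContDiffOn ℝ ∞ (fun q : ℝ × ℝ => Φ q.1 q.2) (Set.Ioo (-ε) ε ×ˢ I)
  mem : ∀ t ∈ Set.Ioo (-ε) ε, ∀ s ∈ I, Φ t s ∈ SL2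
  zero : ∀ s ∈ I, Φ 0 s = γ s
  fixed : ∀ t ∈ Set.Ioo (-ε) ε, ∀ s ∈ I, s ∉ Set.Icc a b → Φ t s = γ s

/-- `γ : I → SL(2,ℝ)_τ` is biharmonic: it is a critical point of the bienergy with respect to
compactly supported smooth variations. -/
def IsBiharmonic (τ : ℝ) (I : Set ℝ) (γ : ℝ → ℂ × ℂ) : Prop :=
  ∀ a b : ℝ, a < b → Set.Icc a b ⊆ I → ∀ ε : ℝ, 0 < ε → ∀ Φ : ℝ → ℝ → ℂ × ℂ,
    IsVariation I γ a b ε Φ → HasDerivAt (fun t => bienergy τ (Φ t) a b) 0 0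

/-- `γ : I → SL(2,ℝ)_τ` is a geodesic: its tension field vanishes identically. -/
def IsGeodesic (τ : ℝ) (I : Set ℝ) (γ : ℝ → ℂ × ℂ) : Prop :=
  ∀ s ∈ I, tension τ γ s = 0

/-- Proper biharmonic: biharmonic and not a geodesic. -/
def IsProperBiharmonic (τ : ℝ) (I : Set ℝ) (γ : ℝ → ℂ × ℂ) : Prop :=
  IsBiharmonic τ I γ ∧ ¬ IsGeodesic τ I γ

/-- `γ : I → SL(2,ℝ)_τ` is a smooth curve parametrized by arc length. -/
structure IsArcLengthCurve (τ : ℝ) (I : Set ℝ) (γ : ℝ → ℂ × ℂ) : Prop where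
  smooth : ContDiffOn ℝ ∞ γ I
  mem : ∀ s ∈ I, γ s ∈ SL2
  unit_speed : ∀ s ∈ I, metric τ (γ s) (deriv γ s) (deriv γ s) = 1

/-- The geodesic curvature `k₁ = |∇_T T|`. -/
def k1 (τ : ℝ) (γ : ℝ → ℂ × ℂ) (s : ℝ) : ℝ :=
  Real.sqrt (metric τ (γ s) (tension τ γ s) (tension τ γ s))

/-- The unit normal `N = ∇_T T / k₁` (meaningful where `k₁ ≠ 0`). -/
def normal (τ : ℝ) (γ : ℝ → ℂ × ℂ) (s : ℝ) : ℂ × ℂ := (k1 τ γ s)⁻¹ • tension τ γ s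

/-- The vector product on the tangent space at `p` for which `(E₁, E₂, E₃)` is positively
oriented. -/
def cross (τ : ℝ) (p V W : ℂ × ℂ) : ℂ × ℂ :=
  (comp τ p V 1 * comp τ p W 2 - comp τ p V 2 * comp τ p W 1) • frame τ 0 p
    + (comp τ p V 2 * comp τ p W 0 - comp τ p V 0 * comp τ p W 2) • frame τ 1 p
    + (comp τ p V 0 * comp τ p W 1 - comp τ p V 1 * comp τ p W 0) • frame τ 2 p

/-- The binormal `B = T ∧ N`, so that `(T, N, B)` is a positive orthonormal frame. -/
def binormal (τ : ℝ) (γ : ℝ → ℂ × ℂ) (s : ℝ) : ℂ × ℂ :=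
  cross τ (γ s) (deriv γ s) (normal τ γ s)

/-- The geodesic torsion `k₂ = g_τ(∇_T N, B)`. -/
def k2 (τ : ℝ) (γ : ℝ → ℂ × ℂ) (s : ℝ) : ℝ :=
  metric τ (γ s) (covDeriv τ γ (normal τ γ) s) (binormal τ γ s)

end SLTau

end

/-! The fields `E_i` are restrictions of linear maps of `ℂ × ℂ`, and their brackets have constant
coefficients in the frame. In components the covariant derivative along a curve is therefore `d/ds`
plus a fixed bilinear form `connForm`, and a curve is handled through its velocity `v : ℝ → ℝ³` with
the ordinary dot and cross products.

Biharmonicity becomes the equation `bitension = 0`, that is `∇_T³ T + R(∇_T T, T) T = 0`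
(`isBiharmonic_iff`). For a variation with velocity `v` and variation field `w`, the structure
equation `∂_t v = ∂_s w + [v, w]` (`dt_comp_ds`) allows `∂_t` to be commuted past the covariant
derivatives (`dt_covs_self`). Integration by parts then gives the derivative `∫ ⟨bitension, w⟩` of
the bienergy. Flows of the frame fields realise enough variation fields for the fundamental lemma of
the calculus of variations.

Let `a = ∇_T T`. The equation is tested against `v`, `a` and `v × a` (`bitension_eq_zero_iff`). The
`v` part is `-(3/2) (|a|²)'`, so `k₁` is constant. By the curvature formula `curv_dotProduct`, the
other two parts are, up to powers of `k₁`, the two displayed equations. Non-geodesic means that the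
constant `k₁` is nonzero. -/

noncomputable section

namespace SLTau

open Matrix Set

/-! ### The orthonormal frame -/

lemma ip_eq_one {p : ℂ × ℂ} (hp : p ∈ SL2) :
    p.1.re * p.1.re + p.1.im * p.1.im - p.2.re * p.2.re - p.2.im * p.2.im = 1 := hp

lemma comp_zero_eq (τ : ℝ) (p V : ℂ × ℂ) :
    comp τ p V 0 = τ⁻¹ * ip V (X1 p) * (1 - (1 + τ ^ 2) * ip p p) := by
  simp [comp, metric, frame, ip, X1]; ring

lemma comp_one_eq (τ : ℝ) (p V : ℂ × ℂ) : comp τ p V 1 = -ip V (X2 p) := by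
  simp [comp, metric, frame, ip, X1, X2]; ring_nf; simp

lemma comp_two_eq (τ : ℝ) (p V : ℂ × ℂ) : comp τ p V 2 = -ip V (X3 p) := by
  simp [comp, metric, frame, ip, X1, X3]; ring_nf; simp

lemma comp_zero_of_mem {τ : ℝ} (hτ : τ ≠ 0) {p : ℂ × ℂ} (hp : p ∈ SL2) (V : ℂ × ℂ) :
    comp τ p V 0 = -τ * ip V (X1 p) := by
  rw [comp_zero_eq, show ip p p = 1 from hp]; field_simp; ring

/-- The tangent vector at `p` with components `x` in the orthonormal frame. -/
def ofComp (τ : ℝ) (p : ℂ × ℂ) (x : Fin 3 → ℝ) : ℂ × ℂ := ∑ k, x k • frame τ k p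

lemma ofComp_eq (τ : ℝ) (p : ℂ × ℂ) (x : Fin 3 → ℝ) :
    ofComp τ p x = x 0 • ((-τ⁻¹) • X1 p) + x 1 • X2 p + x 2 • X3 p := by
  simp [ofComp, Fin.sum_univ_three, frame]

lemma comp_ofComp {τ : ℝ} (hτ : τ ≠ 0) {p : ℂ × ℂ} (hp : p ∈ SL2) (x : Fin 3 → ℝ) :
    comp τ p (ofComp τ p x) = x := by
  have h := ip_eq_one hp
  funext k
  fin_cases k
  · show comp τ p _ 0 = x 0
    rw [comp_zero_of_mem hτ hp, ofComp_eq]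
    simp [ip, X1, X2, X3]
    field_simp
    linear_combination (x 0) * h
  · show comp τ p _ 1 = x 1
    rw [comp_one_eq, ofComp_eq]
    simp [ip, X1, X2, X3]
    linear_combination (x 1) * h
  · show comp τ p _ 2 = x 2
    rw [comp_two_eq, ofComp_eq]
    simp [ip, X1, X2, X3]
    linear_combination (x 2) * h

lemma ofComp_comp {τ : ℝ} (hτ : τ ≠ 0) {p V : ℂ × ℂ} (hp : p ∈ SL2) (hV : ip V p = 0) :
    ofComp τ p (comp τ p V) = V := by
  have h := ip_eq_one hp
  have hV' : V.1.re * p.1.re + V.1.im * p.1.im - V.2.re * p.2.re - V.2.im * p.2.im = 0 := hV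
  rw [ofComp_eq, comp_zero_of_mem hτ hp, comp_one_eq, comp_two_eq]
  refine Prod.ext (Complex.ext ?_ ?_) (Complex.ext ?_ ?_) <;> simp [ip, X1, X2, X3] <;> field_simp
  · linear_combination V.1.re * h - p.1.re * hV'
  · linear_combination V.1.im * h - p.1.im * hV'
  · linear_combination V.2.re * h - p.2.re * hV'
  · linear_combination V.2.im * h - p.2.im * hV'

lemma metric_ofComp {τ : ℝ} (hτ : τ ≠ 0) {p : ℂ × ℂ} (hp : p ∈ SL2) (x y : Fin 3 → ℝ) :
    metric τ p (ofComp τ p x) (ofComp τ p y) = x ⬝ᵥ y := by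
  have hl : metric τ p (ofComp τ p x) (ofComp τ p y) = ∑ k, y k * comp τ p (ofComp τ p x) k := by
    simp only [Fin.sum_univ_three]
    simp [comp, metric, ofComp_eq, frame, ip]
    ring
  rw [hl, comp_ofComp hτ hp]
  simp [dotProduct, mul_comm]

lemma ofComp_smul (τ : ℝ) (p : ℂ × ℂ) (r : ℝ) (x : Fin 3 → ℝ) :
    ofComp τ p (r • x) = r • ofComp τ p x := by
  simp [ofComp, Finset.smul_sum, smul_smul]

lemma cross_ofComp {τ : ℝ} (hτ : τ ≠ 0) {p : ℂ × ℂ} (hp : p ∈ SL2) (x y : Fin 3 → ℝ) :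
    cross τ p (ofComp τ p x) (ofComp τ p y) = ofComp τ p (crossProduct x y) := by
  rw [cross, comp_ofComp hτ hp, comp_ofComp hτ hp]
  simp [ofComp, Fin.sum_univ_three, cross_apply]

/-! ### The Levi-Civita connection in the frame -/

lemma isLinearMap_frame (τ : ℝ) (i : Fin 3) : IsLinearMap ℝ (frame τ i) := by
  constructor
  · intro x y
    fin_cases i <;> ext <;> simp [frame, X1, X2, X3] <;> ring
  · intro r x
    fin_cases i <;> ext <;> simp [frame, X1, X2, X3] <;> ring

/-- A linear field is its own derivative, so the bracket is a commutator of linear maps. -/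
lemma lieBracket_frame (τ : ℝ) (i j : Fin 3) (p : ℂ × ℂ) :
    VectorField.lieBracket ℝ (frame τ i) (frame τ j) p
      = frame τ j (frame τ i p) - frame τ i (frame τ j p) := by
  have h : ∀ i, fderiv ℝ (frame τ i) p
      = LinearMap.toContinuousLinearMap ((isLinearMap_frame τ i).mk') := fun i =>
    (LinearMap.toContinuousLinearMap ((isLinearMap_frame τ i).mk')).hasFDerivAt.fderiv
  simp [VectorField.lieBracket, h]

/-- The components of the bracket of the fields with constant components `x`, `y`. -/
def frameBracket (τ : ℝ) (x y : Fin 3 → ℝ) : Fin 3 → ℝ :=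
  ![2 * τ * (x 1 * y 2 - x 2 * y 1), -(2 * τ⁻¹) * (x 2 * y 0 - x 0 * y 2),
    -(2 * τ⁻¹) * (x 0 * y 1 - x 1 * y 0)]

lemma lieBracket_frame_eq_ofComp {τ : ℝ} (hτ : τ ≠ 0) (i j : Fin 3) (p : ℂ × ℂ) :
    VectorField.lieBracket ℝ (frame τ i) (frame τ j) p
      = ofComp τ p (frameBracket τ (Pi.single i 1) (Pi.single j 1)) := by
  rw [lieBracket_frame, ofComp_eq]
  fin_cases i <;> fin_cases j <;> refine Prod.ext (Complex.ext ?_ ?_) (Complex.ext ?_ ?_) <;>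
    simp [frame, frameBracket, X1, X2, X3] <;> first | ring1 | (field_simp; try ring1)

lemma bracketCoeff_eq {τ : ℝ} (hτ : τ ≠ 0) {p : ℂ × ℂ} (hp : p ∈ SL2) (i j k : Fin 3) :
    bracketCoeff τ p i j k = frameBracket τ (Pi.single i 1) (Pi.single j 1) k := by
  rw [bracketCoeff, lieBracket_frame_eq_ofComp hτ]
  exact congrFun (comp_ofComp hτ hp _) k

/-- The connection in the frame: the components of `∇_x y` for constant components `x`, `y`. -/
def connForm (τ : ℝ) (x y : Fin 3 → ℝ) : Fin 3 → ℝ :=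
  ![τ * (x 1 * y 2 - x 2 * y 1), τ * x 2 * y 0 + (τ + 2 * τ⁻¹) * x 0 * y 2,
    -(τ + 2 * τ⁻¹) * x 0 * y 1 - τ * x 1 * y 0]

/-- The right side does not involve `p`: constant structure coefficients make the Koszul formula
constant too. -/
lemma sum_connCoeff {τ : ℝ} (hτ : τ ≠ 0) {p : ℂ × ℂ} (hp : p ∈ SL2) (x y : Fin 3 → ℝ)
    (k : Fin 3) :
    ∑ i : Fin 3, ∑ j : Fin 3, x i * y j * connCoeff τ p i j k = connForm τ x y k := by
  simp only [connCoeff, bracketCoeff_eq hτ hp, Fin.sum_univ_three]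
  fin_cases k <;> simp [frameBracket, connForm] <;> ring

lemma covDeriv_eq {τ : ℝ} (hτ : τ ≠ 0) {c V : ℝ → ℂ × ℂ} {s : ℝ} (hp : c s ∈ SL2) :
    covDeriv τ c V s = ofComp τ (c s) (fun k => deriv (fun u => comp τ (c u) (V u) k) s
      + connForm τ (comp τ (c s) (deriv c s)) (comp τ (c s) (V s)) k) := by
  simp only [covDeriv, sum_connCoeff hτ hp, ofComp]

/-! ### Algebra of the connection form -/

lemma connForm_smul_right (τ r : ℝ) (x y : Fin 3 → ℝ) :
    connForm τ x (r • y) = r • connForm τ x y := by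
  ext k; fin_cases k <;> simp [connForm] <;> ring

/-- The connection form is metric. -/
lemma connForm_dotProduct (τ : ℝ) (x y z : Fin 3 → ℝ) :
    connForm τ x y ⬝ᵥ z + y ⬝ᵥ connForm τ x z = 0 := by
  simp [connForm, dotProduct, Fin.sum_univ_three]; ring

/-- The connection form acts by derivations of the vector product. -/
lemma connForm_cross (τ : ℝ) (x y z : Fin 3 → ℝ) :
    connForm τ x (crossProduct y z)
      = crossProduct (connForm τ x y) z + crossProduct y (connForm τ x z) := by
  ext k; fin_cases k <;> simp [connForm, cross_apply] <;> ring

/-- The connection form is torsion free. -/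
lemma connForm_sub_connForm (τ : ℝ) (x y : Fin 3 → ℝ) :
    connForm τ x y - connForm τ y x = frameBracket τ x y := by
  ext k; fin_cases k <;> simp [connForm, frameBracket] <;> ring

/-- The components of `R(x, y) z` in the frame. -/
def curv (τ : ℝ) (x y z : Fin 3 → ℝ) : Fin 3 → ℝ :=
  connForm τ x (connForm τ y z) - connForm τ y (connForm τ x z)
    - connForm τ (frameBracket τ x y) z

/-- When planes are encoded by their normals, the curvature operator is diagonal: planes containing
`E₁` have curvature `τ²`, the horizontal plane `τ² - 4(1 + τ²)`. The symmetry in `x` and `z` is what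
integration by parts needs. -/
lemma curv_dotProduct {τ : ℝ} (hτ : τ ≠ 0) (x y z : Fin 3 → ℝ) :
    curv τ x y y ⬝ᵥ z = τ ^ 2 * (crossProduct y x ⬝ᵥ crossProduct y z)
      - 4 * (1 + τ ^ 2) * (crossProduct y x 0 * crossProduct y z 0) := by
  simp [curv, connForm, frameBracket, dotProduct, Fin.sum_univ_three, cross_apply]
  field_simp
  ring

lemma curv_dotProduct_self {τ : ℝ} (x y : Fin 3 → ℝ) : curv τ x y y ⬝ᵥ y = 0 := by
  simp [curv, connForm, frameBracket, dotProduct, Fin.sum_univ_three]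
  ring

/-! ### Smoothness and derivatives of the component functions -/

section Smoothness

variable {E : Type*} [NormedAddCommGroup E] [NormedSpace ℝ E] {U : Set E}

lemma contDiffOn_ip {f g : E → ℂ × ℂ} (hf : ContDiffOn ℝ ∞ f U) (hg : ContDiffOn ℝ ∞ g U) :
    ContDiffOn ℝ ∞ (fun q => ip (f q) (g q)) U := by
  have re {h : E → ℂ} (hh : ContDiffOn ℝ ∞ h U) : ContDiffOn ℝ ∞ (fun q => (h q).re) U :=
    Complex.reCLM.contDiff.comp_contDiffOn hh
  have im {h : E → ℂ} (hh : ContDiffOn ℝ ∞ h U) : ContDiffOn ℝ ∞ (fun q => (h q).im) U :=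
    Complex.imCLM.contDiff.comp_contDiffOn hh
  exact ((((re hf.fst).mul (re hg.fst)).add ((im hf.fst).mul (im hg.fst))).sub
    ((re hf.snd).mul (re hg.snd))).sub ((im hf.snd).mul (im hg.snd))

lemma contDiff_frame (τ : ℝ) (i : Fin 3) : ContDiff ℝ ∞ (frame τ i) :=
  (LinearMap.toContinuousLinearMap ((isLinearMap_frame τ i).mk')).contDiff

lemma contDiff_X1 : ContDiff ℝ ∞ X1 := by
  unfold X1
  fun_prop

lemma contDiffOn_comp {τ : ℝ} {f g : E → ℂ × ℂ} (hf : ContDiffOn ℝ ∞ f U)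
    (hg : ContDiffOn ℝ ∞ g U) : ContDiffOn ℝ ∞ (fun q => comp τ (f q) (g q)) U := by
  rw [contDiffOn_pi]
  intro k
  have h1 := contDiff_X1.comp_contDiffOn hf
  have h2 := (contDiff_frame τ k).comp_contDiffOn hf
  exact (contDiffOn_ip hg h2).neg.add
    ((contDiffOn_const.mul (contDiffOn_ip hg h1)).mul (contDiffOn_ip h2 h1))

lemma contDiffOn_connForm {τ : ℝ} {x y : E → Fin 3 → ℝ} (hx : ContDiffOn ℝ ∞ x U)
    (hy : ContDiffOn ℝ ∞ y U) : ContDiffOn ℝ ∞ (fun q => connForm τ (x q) (y q)) U := by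
  rw [contDiffOn_pi] at hx hy ⊢
  have h := fun i j => (hx i).mul (hy j)
  intro k
  fin_cases k
  · exact contDiffOn_const.mul ((h 1 2).sub (h 2 1))
  · refine ((contDiffOn_const (c := τ)).mul (h 2 0)).add
      ((contDiffOn_const (c := τ + 2 * τ⁻¹)).mul (h 0 2)) |>.congr fun q _ => ?_
    simp [connForm, mul_assoc]
  · refine ((contDiffOn_const (c := -(τ + 2 * τ⁻¹))).mul (h 0 1)).sub
      ((contDiffOn_const (c := τ)).mul (h 1 0)) |>.congr fun q _ => ?_
    simp [connForm, mul_assoc]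

lemma contDiffOn_dotProduct {x y : E → Fin 3 → ℝ} (hx : ContDiffOn ℝ ∞ x U)
    (hy : ContDiffOn ℝ ∞ y U) : ContDiffOn ℝ ∞ (fun q => x q ⬝ᵥ y q) U := by
  rw [contDiffOn_pi] at hx hy
  exact ContDiffOn.sum fun i _ => (hx i).mul (hy i)

lemma contDiffOn_fderiv_apply {F : Type*} [NormedAddCommGroup F] [NormedSpace ℝ F] {f : E → F}
    (hU : IsOpen U) (hf : ContDiffOn ℝ ∞ f U) (e : E) :
    ContDiffOn ℝ ∞ (fun q => fderiv ℝ f q e) U :=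
  (hf.fderiv_of_isOpen hU (by simp)).clm_apply contDiffOn_const

end Smoothness

lemma hasDerivAt_ip {f g : ℝ → ℂ × ℂ} {f' g' : ℂ × ℂ} {s : ℝ} (hf : HasDerivAt f f' s)
    (hg : HasDerivAt g g' s) :
    HasDerivAt (fun u => ip (f u) (g u)) (ip f' (g s) + ip (f s) g') s := by
  have re {h : ℝ → ℂ} {h' : ℂ} (hh : HasDerivAt h h' s) :
      HasDerivAt (fun q => (h q).re) h'.re s := Complex.reCLM.hasFDerivAt.comp_hasDerivAt s hh
  have im {h : ℝ → ℂ} {h' : ℂ} (hh : HasDerivAt h h' s) :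
      HasDerivAt (fun q => (h q).im) h'.im s := Complex.imCLM.hasFDerivAt.comp_hasDerivAt s hh
  have f1 : HasDerivAt (fun u => (f u).1) f'.1 s := hf.fst
  have f2 : HasDerivAt (fun u => (f u).2) f'.2 s := hf.snd
  have g1 : HasDerivAt (fun u => (g u).1) g'.1 s := hg.fst
  have g2 : HasDerivAt (fun u => (g u).2) g'.2 s := hg.snd
  refine (((((re f1).mul (re g1)).add ((im f1).mul (im g1))).sub
    ((re f2).mul (re g2))).sub ((im f2).mul (im g2))).congr_deriv ?_
  simp only [ip]; ring

lemma hasDerivAt_frame {τ : ℝ} {i : Fin 3} {f : ℝ → ℂ × ℂ} {f' : ℂ × ℂ} {s : ℝ}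
    (hf : HasDerivAt f f' s) : HasDerivAt (fun u => frame τ i (f u)) (frame τ i f') s :=
  (LinearMap.toContinuousLinearMap
    ((isLinearMap_frame τ i).mk')).hasFDerivAt.comp_hasDerivAt s hf

lemma hasDerivAt_dotProduct {x y : ℝ → Fin 3 → ℝ} {x' y' : Fin 3 → ℝ} {s : ℝ}
    (hx : HasDerivAt x x' s) (hy : HasDerivAt y y' s) :
    HasDerivAt (fun u => x u ⬝ᵥ y u) (x' ⬝ᵥ y s + x s ⬝ᵥ y') s := by
  rw [hasDerivAt_pi] at hx hy
  refine (HasDerivAt.fun_sum (u := Finset.univ) fun i _ => (hx i).mul (hy i)).congr_deriv ?_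
  simp [dotProduct, Finset.sum_add_distrib]

lemma hasDerivAt_connForm {τ : ℝ} {x y : ℝ → Fin 3 → ℝ} {x' y' : Fin 3 → ℝ} {s : ℝ}
    (hx : HasDerivAt x x' s) (hy : HasDerivAt y y' s) :
    HasDerivAt (fun u => connForm τ (x u) (y u))
      (connForm τ x' (y s) + connForm τ (x s) y') s := by
  rw [hasDerivAt_pi] at hx hy ⊢
  have h := fun i j => (hx i).mul (hy j)
  intro k
  fin_cases k
  · refine (((h 1 2).sub (h 2 1)).const_mul τ).congr_deriv ?_
    simp [connForm]; ring
  · refine ((((h 2 0).const_mul τ).add ((h 0 2).const_mul (τ + 2 * τ⁻¹))).congr_deriv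
      ?_).congr_of_eventuallyEq (.of_forall fun u => ?_)
    · simp [connForm]; ring
    · simp [connForm, mul_assoc]
  · refine ((((h 0 1).const_mul (-(τ + 2 * τ⁻¹))).sub ((h 1 0).const_mul τ)).congr_deriv
      ?_).congr_of_eventuallyEq (.of_forall fun u => ?_)
    · simp [connForm]; ring
    · simp [connForm, mul_assoc]

lemma hasDerivAt_cross {x y : ℝ → Fin 3 → ℝ} {x' y' : Fin 3 → ℝ} {s : ℝ}
    (hx : HasDerivAt x x' s) (hy : HasDerivAt y y' s) :
    HasDerivAt (fun u => crossProduct (x u) (y u))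
      (crossProduct x' (y s) + crossProduct (x s) y') s := by
  rw [hasDerivAt_pi] at hx hy ⊢
  have h := fun i j => (hx i).mul (hy j)
  intro k
  fin_cases k
  · refine ((h 1 2).sub (h 2 1)).congr_deriv ?_
    simp [cross_apply]; ring
  · refine ((h 2 0).sub (h 0 2)).congr_deriv ?_
    simp [cross_apply]; ring
  · refine ((h 0 1).sub (h 1 0)).congr_deriv ?_
    simp [cross_apply]; ring

/-! ### Curves in components -/

/-- The components of the velocity of a curve. -/
def vel (τ : ℝ) (c : ℝ → ℂ × ℂ) (s : ℝ) : Fin 3 → ℝ := comp τ (c s) (deriv c s)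

/-- The covariant derivative in components, along a curve with velocity components `v`. -/
def cov (τ : ℝ) (v x : ℝ → Fin 3 → ℝ) (s : ℝ) : Fin 3 → ℝ :=
  deriv x s + connForm τ (v s) (x s)

/-- The components of the bitension field of a curve with velocity components `v`. -/
def bitension (τ : ℝ) (v : ℝ → Fin 3 → ℝ) (s : ℝ) : Fin 3 → ℝ :=
  cov τ v (cov τ v (cov τ v v)) s + curv τ (cov τ v v s) (v s) (v s)

lemma contDiffOn_deriv {F : Type*} [NormedAddCommGroup F] [NormedSpace ℝ F] {I : Set ℝ}
    (hI : IsOpen I) {x : ℝ → F} (hx : ContDiffOn ℝ ∞ x I) : ContDiffOn ℝ ∞ (deriv x) I :=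
  hx.deriv_of_isOpen hI (by simp)

lemma hasDerivAt_of_contDiffOn {F : Type*} [NormedAddCommGroup F] [NormedSpace ℝ F] {I : Set ℝ}
    (hI : IsOpen I) {x : ℝ → F} (hx : ContDiffOn ℝ ∞ x I) {s : ℝ} (hs : s ∈ I) :
    HasDerivAt x (deriv x s) s :=
  ((hx.contDiffAt (hI.mem_nhds hs)).differentiableAt (by simp)).hasDerivAt

section Curves

variable {τ : ℝ} {I : Set ℝ} {v x y : ℝ → Fin 3 → ℝ} {c : ℝ → ℂ × ℂ} {s : ℝ}

lemma contDiffOn_cov (hI : IsOpen I) (hv : ContDiffOn ℝ ∞ v I) (hx : ContDiffOn ℝ ∞ x I) :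
    ContDiffOn ℝ ∞ (cov τ v x) I :=
  (contDiffOn_deriv hI hx).add (contDiffOn_connForm hv hx)

lemma hasDerivAt_dotProduct_cov (hI : IsOpen I) (hx : ContDiffOn ℝ ∞ x I)
    (hy : ContDiffOn ℝ ∞ y I) (hs : s ∈ I) :
    HasDerivAt (fun u => x u ⬝ᵥ y u) (cov τ v x s ⬝ᵥ y s + x s ⬝ᵥ cov τ v y s) s := by
  convert hasDerivAt_dotProduct (hasDerivAt_of_contDiffOn hI hx hs)
    (hasDerivAt_of_contDiffOn hI hy hs) using 1
  simp only [cov, add_dotProduct, dotProduct_add]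
  linear_combination connForm_dotProduct τ (v s) (x s) (y s)

lemma hasDerivAt_triple_cov {z : ℝ → Fin 3 → ℝ} (hI : IsOpen I) (hx : ContDiffOn ℝ ∞ x I)
    (hy : ContDiffOn ℝ ∞ y I) (hz : ContDiffOn ℝ ∞ z I) (hs : s ∈ I) :
    HasDerivAt (fun u => x u ⬝ᵥ crossProduct (y u) (z u))
      (cov τ v x s ⬝ᵥ crossProduct (y s) (z s)
        + x s ⬝ᵥ (crossProduct (cov τ v y s) (z s) + crossProduct (y s) (cov τ v z s))) s := by
  convert hasDerivAt_dotProduct (hasDerivAt_of_contDiffOn hI hx hs)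
    (hasDerivAt_cross (hasDerivAt_of_contDiffOn hI hy hs)
      (hasDerivAt_of_contDiffOn hI hz hs)) using 1
  have h := connForm_dotProduct τ (v s) (x s) (crossProduct (y s) (z s))
  rw [connForm_cross] at h
  simp only [cov, add_dotProduct, dotProduct_add, map_add, LinearMap.add_apply] at h ⊢
  linear_combination h

lemma contDiffOn_vel (hI : IsOpen I) (hc : ContDiffOn ℝ ∞ c I) : ContDiffOn ℝ ∞ (vel τ c) I :=
  contDiffOn_comp hc (contDiffOn_deriv hI hc)

lemma ip_comm (p q : ℂ × ℂ) : ip p q = ip q p := by simp only [ip]; ring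

lemma ip_eq_zero_of_hasDerivAt {p' : ℂ × ℂ} (hc : HasDerivAt c p' s)
    (hmem : ∀ᶠ u in nhds s, c u ∈ SL2) : ip p' (c s) = 0 := by
  have h := hasDerivAt_ip hc hc
  have h0 : HasDerivAt (fun u => ip (c u) (c u)) 0 s :=
    (hasDerivAt_const s (1 : ℝ)).congr_of_eventuallyEq hmem
  have := h.unique h0
  rw [ip_comm (c s)] at this
  linarith

lemma ofComp_vel (hτ : τ ≠ 0) (hI : IsOpen I) (hc : ContDiffOn ℝ ∞ c I)
    (hmem : ∀ s ∈ I, c s ∈ SL2) (hs : s ∈ I) : ofComp τ (c s) (vel τ c s) = deriv c s :=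
  ofComp_comp hτ (hmem s hs) (ip_eq_zero_of_hasDerivAt (hasDerivAt_of_contDiffOn hI hc hs)
    (Filter.eventually_of_mem (hI.mem_nhds hs) hmem))

/-- The passage from fields along a curve to component functions; afterwards the ambient space is no
longer needed. -/
lemma covDeriv_ofComp (hτ : τ ≠ 0) (hI : IsOpen I) (hmem : ∀ s ∈ I, c s ∈ SL2)
    {V : ℝ → ℂ × ℂ} (hx : ContDiffOn ℝ ∞ x I) (hV : ∀ s ∈ I, V s = ofComp τ (c s) (x s))
    (hs : s ∈ I) : covDeriv τ c V s = ofComp τ (c s) (cov τ (vel τ c) x s) := by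
  have hcomp : ∀ u ∈ I, comp τ (c u) (V u) = x u := fun u hu => by
    rw [hV u hu, comp_ofComp hτ (hmem u hu)]
  rw [covDeriv_eq hτ (hmem s hs)]
  congr 1
  funext k
  have hk : (fun u => comp τ (c u) (V u) k) =ᶠ[nhds s] fun u => x u k :=
    Filter.eventually_of_mem (hI.mem_nhds hs) fun u hu => congrFun (hcomp u hu) k
  rw [hk.deriv_eq, hcomp s hs,
    (hasDerivAt_pi.1 (hasDerivAt_of_contDiffOn hI hx hs) k).deriv]
  rfl

lemma tension_eq (hτ : τ ≠ 0) (hI : IsOpen I) (hc : ContDiffOn ℝ ∞ c I)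
    (hmem : ∀ s ∈ I, c s ∈ SL2) (hs : s ∈ I) :
    tension τ c s = ofComp τ (c s) (cov τ (vel τ c) (vel τ c) s) :=
  covDeriv_ofComp hτ hI hmem (contDiffOn_vel hI hc)
    (fun _ hu => (ofComp_vel hτ hI hc hmem hu).symm) hs

end Curves

/-! ### Unit speed curves: the bitension field in the Frenet frame -/

/-- The Gram determinant of `x, v, a` is the square of their triple product. For `v ⟂ a` this is
Parseval in the basis `v, a, v × a`, free of division by norms. -/
lemma dotProduct_triple (x v a : Fin 3 → ℝ) :
    (x ⬝ᵥ x) * ((v ⬝ᵥ v) * (a ⬝ᵥ a) - (a ⬝ᵥ v) ^ 2)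
      = (x ⬝ᵥ crossProduct v a) ^ 2 + (v ⬝ᵥ v) * (x ⬝ᵥ a) ^ 2 + (a ⬝ᵥ a) * (x ⬝ᵥ v) ^ 2
        - 2 * (x ⬝ᵥ a) * (x ⬝ᵥ v) * (a ⬝ᵥ v) := by
  simp [dotProduct, Fin.sum_univ_three, cross_apply]; ring

section UnitSpeed

variable {τ : ℝ} {I : Set ℝ} {v : ℝ → Fin 3 → ℝ} {s : ℝ}

lemma cov_self_dotProduct (hI : IsOpen I) (hv : ContDiffOn ℝ ∞ v I)
    (hunit : ∀ s ∈ I, v s ⬝ᵥ v s = 1) (hs : s ∈ I) : cov τ v v s ⬝ᵥ v s = 0 := by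
  have h := (hasDerivAt_dotProduct_cov (τ := τ) (v := v) hI hv hv hs).unique
    ((hasDerivAt_const s (1 : ℝ)).congr_of_eventuallyEq
      (Filter.eventually_of_mem (hI.mem_nhds hs) hunit))
  rw [dotProduct_comm (v s)] at h
  linarith

lemma cov_cov_dotProduct (hI : IsOpen I) (hv : ContDiffOn ℝ ∞ v I)
    (hunit : ∀ s ∈ I, v s ⬝ᵥ v s = 1) (hs : s ∈ I) :
    cov τ v (cov τ v v) s ⬝ᵥ v s = -(cov τ v v s ⬝ᵥ cov τ v v s) := by
  have h := (hasDerivAt_dotProduct_cov (τ := τ) (v := v) hI (contDiffOn_cov (τ := τ) hI hv hv) hv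
    hs).unique
    ((hasDerivAt_const s (0 : ℝ)).congr_of_eventuallyEq
      (Filter.eventually_of_mem (hI.mem_nhds hs) fun u hu => cov_self_dotProduct hI hv hunit hu))
  linarith

lemma hasDerivAt_cov_dotProduct_cov (hI : IsOpen I) (hv : ContDiffOn ℝ ∞ v I) (hs : s ∈ I) :
    HasDerivAt (fun u => cov τ v v u ⬝ᵥ cov τ v v u)
      (2 * (cov τ v (cov τ v v) s ⬝ᵥ cov τ v v s)) s := by
  have ha := contDiffOn_cov (τ := τ) hI hv hv
  refine (hasDerivAt_dotProduct_cov (τ := τ) (v := v) hI ha ha hs).congr_deriv ?_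
  rw [dotProduct_comm (cov τ v v s)]; ring

/-- Differentiating `⟨∇a, v⟩ = -⟨a, a⟩` gives `⟨∇²a, v⟩ = -3⟨∇a, a⟩`, and the curvature term is
orthogonal to `v`. -/
lemma bitension_dotProduct_vel (hI : IsOpen I) (hv : ContDiffOn ℝ ∞ v I)
    (hunit : ∀ s ∈ I, v s ⬝ᵥ v s = 1) (hs : s ∈ I) :
    bitension τ v s ⬝ᵥ v s = -3 * (cov τ v (cov τ v v) s ⬝ᵥ cov τ v v s) := by
  have ha := contDiffOn_cov (τ := τ) hI hv hv
  have h := (hasDerivAt_dotProduct_cov (τ := τ) (v := v) hI (contDiffOn_cov hI hv ha) hv hs).unique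
    ((hasDerivAt_cov_dotProduct_cov (τ := τ) hI hv hs).neg.congr_of_eventuallyEq
      (Filter.eventually_of_mem (hI.mem_nhds hs) fun u hu => cov_cov_dotProduct hI hv hunit hu))
  rw [bitension, add_dotProduct, curv_dotProduct_self]
  linarith

lemma cov_cov_dotProduct_cov_eq_zero (hI : IsOpen I) {r : ℝ} (hv : ContDiffOn ℝ ∞ v I)
    (hr : ∀ s ∈ I, cov τ v v s ⬝ᵥ cov τ v v s = r) (hs : s ∈ I) :
    cov τ v (cov τ v v) s ⬝ᵥ cov τ v v s = 0 := by
  have h := (hasDerivAt_cov_dotProduct_cov (τ := τ) hI hv hs).unique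
    ((hasDerivAt_const s r).congr_of_eventuallyEq
      (Filter.eventually_of_mem (hI.mem_nhds hs) hr))
  linarith

/-- The norm of the tension field is constant when the bitension field vanishes. -/
lemma exists_cov_dotProduct_cov_eq (hI : IsOpen I) (hIc : I.OrdConnected)
    (hv : ContDiffOn ℝ ∞ v I) (hunit : ∀ s ∈ I, v s ⬝ᵥ v s = 1)
    (hb : ∀ s ∈ I, bitension τ v s = 0) :
    ∃ r, ∀ s ∈ I, cov τ v v s ⬝ᵥ cov τ v v s = r := by
  refine hI.exists_is_const_of_deriv_eq_zero hIc.isPreconnected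
    (fun s hs => (hasDerivAt_cov_dotProduct_cov (τ := τ) hI
      hv hs).differentiableAt.differentiableWithinAt) fun s hs => ?_
  have h := bitension_dotProduct_vel (τ := τ) hI hv hunit hs
  rw [hb s hs, zero_dotProduct] at h
  rw [(hasDerivAt_cov_dotProduct_cov (τ := τ) hI hv hs).deriv]
  simp only [Pi.zero_apply]
  linarith

/-- The square of the geodesic curvature times the geodesic torsion, in components. -/
def torsionNum (τ : ℝ) (v : ℝ → Fin 3 → ℝ) (s : ℝ) : ℝ :=
  cov τ v (cov τ v v) s ⬝ᵥ crossProduct (v s) (cov τ v v s)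

/-- Since `⟨∇a, a⟩ = 0`, one more derivative gives `⟨∇²a, a⟩ = -|∇a|²`. The Gram identity evaluates
`r |∇a|²` as `r³ + torsionNum²`; hence the factor `r`. -/
lemma bitension_dotProduct_cov (hτ : τ ≠ 0) (hI : IsOpen I) (hv : ContDiffOn ℝ ∞ v I)
    (hunit : ∀ s ∈ I, v s ⬝ᵥ v s = 1) {r : ℝ}
    (hr : ∀ s ∈ I, cov τ v v s ⬝ᵥ cov τ v v s = r) (hs : s ∈ I) :
    r * (bitension τ v s ⬝ᵥ cov τ v v s) = -(r ^ 3 + torsionNum τ v s ^ 2)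
      + r * (τ ^ 2 * r - 4 * (1 + τ ^ 2) * (crossProduct (v s) (cov τ v v s) 0) ^ 2) := by
  have ha := contDiffOn_cov (τ := τ) hI hv hv
  have h0 : ∀ u ∈ I, cov τ v (cov τ v v) u ⬝ᵥ cov τ v v u = 0 := fun u hu =>
    cov_cov_dotProduct_cov_eq_zero hI hv hr hu
  have h := (hasDerivAt_dotProduct_cov (τ := τ) (v := v) hI (contDiffOn_cov hI hv ha) ha hs).unique
    ((hasDerivAt_const s (0 : ℝ)).congr_of_eventuallyEq
      (Filter.eventually_of_mem (hI.mem_nhds hs) h0))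
  have ht := dotProduct_triple (cov τ v (cov τ v v) s) (v s) (cov τ v v s)
  rw [hunit s hs, hr s hs, cov_self_dotProduct hI hv hunit hs, h0 s hs,
    cov_cov_dotProduct hI hv hunit hs, hr s hs] at ht
  have hc : crossProduct (v s) (cov τ v v s) ⬝ᵥ crossProduct (v s) (cov τ v v s) = r := by
    rw [cross_dot_cross, hunit s hs, hr s hs, dotProduct_comm (v s),
      cov_self_dotProduct hI hv hunit hs]
    ring
  rw [bitension, add_dotProduct, curv_dotProduct hτ, hc]
  rw [torsionNum]
  linear_combination r * h - ht

/-- Only `⟨∇²a, v × a⟩` survives the product rule, because `a × a = 0` and `⟨∇a, v × ∇a⟩ = 0`. -/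
lemma hasDerivAt_torsionNum (hI : IsOpen I) (hv : ContDiffOn ℝ ∞ v I) (hs : s ∈ I) :
    HasDerivAt (torsionNum τ v)
      (bitension τ v s ⬝ᵥ crossProduct (v s) (cov τ v v s)
        - curv τ (cov τ v v s) (v s) (v s) ⬝ᵥ crossProduct (v s) (cov τ v v s)) s := by
  have ha := contDiffOn_cov (τ := τ) hI hv hv
  refine (hasDerivAt_triple_cov (τ := τ) (v := v) hI (contDiffOn_cov hI hv ha) hv ha hs).congr_deriv
    ?_
  rw [bitension, add_dotProduct, cross_self, zero_add, dot_cross_self]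
  ring

lemma curv_dotProduct_cross (hτ : τ ≠ 0) {a v : Fin 3 → ℝ} (hv : v ⬝ᵥ v = 1) (ha : a ⬝ᵥ v = 0) :
    curv τ a v v ⬝ᵥ crossProduct v a = 4 * (1 + τ ^ 2) * (a 0 * crossProduct v a 0) := by
  have h : crossProduct v (crossProduct v a) = -a := by
    have h1 : crossProduct v (crossProduct v a) = (a ⬝ᵥ v) • v - (v ⬝ᵥ v) • a := by
      ext k; fin_cases k <;> simp [dotProduct, Fin.sum_univ_three, cross_apply] <;> ring
    rw [h1, ha, hv]; simp
  rw [curv_dotProduct hτ, h]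
  have h2 : crossProduct v a ⬝ᵥ -a = 0 := by
    simp [dotProduct, Fin.sum_univ_three, cross_apply]; ring
  rw [h2]
  simp only [Pi.neg_apply]
  ring

/-- The Frenet characterization of the vanishing of the bitension field. -/
lemma bitension_eq_zero_iff (hτ : τ ≠ 0) (hI : IsOpen I) (hv : ContDiffOn ℝ ∞ v I)
    (hunit : ∀ s ∈ I, v s ⬝ᵥ v s = 1) {r : ℝ} (hr0 : 0 < r)
    (hr : ∀ s ∈ I, cov τ v v s ⬝ᵥ cov τ v v s = r) (hs : s ∈ I) :
    bitension τ v s = 0 ↔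
      r ^ 3 + torsionNum τ v s ^ 2
        = r * (τ ^ 2 * r - 4 * (1 + τ ^ 2) * (crossProduct (v s) (cov τ v v s) 0) ^ 2) ∧
      HasDerivAt (torsionNum τ v)
        (-(4 * (1 + τ ^ 2) * (cov τ v v s 0 * crossProduct (v s) (cov τ v v s) 0))) s := by
  have ha0 := cov_self_dotProduct (τ := τ) hI hv hunit hs
  have h1 := bitension_dotProduct_cov hτ hI hv hunit hr hs
  have h2 := hasDerivAt_torsionNum (τ := τ) hI hv hs
  rw [curv_dotProduct_cross hτ (hunit s hs) ha0] at h2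
  constructor
  · intro hb
    rw [hb, zero_dotProduct] at h1 h2
    exact ⟨by linarith, by simpa using h2⟩
  · rintro ⟨h3, h4⟩
    have e1 : bitension τ v s ⬝ᵥ v s = 0 := by
      rw [bitension_dotProduct_vel hI hv hunit hs, cov_cov_dotProduct_cov_eq_zero hI hv hr hs]
      ring
    have e2 : bitension τ v s ⬝ᵥ cov τ v v s = 0 := by
      have : r * (bitension τ v s ⬝ᵥ cov τ v v s) = 0 := by linarith
      exact (mul_eq_zero.1 this).resolve_left hr0.ne'
    have e3 : bitension τ v s ⬝ᵥ crossProduct (v s) (cov τ v v s) = 0 := by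
      have := h2.unique h4
      linarith
    -- All three projections vanish, so the Gram identity reduces to `r |bitension|² = 0`.
    have h := dotProduct_triple (bitension τ v s) (v s) (cov τ v v s)
    rw [e1, e2, e3, hunit s hs, hr s hs, ha0] at h
    have : bitension τ v s ⬝ᵥ bitension τ v s = 0 := by
      have : r * (bitension τ v s ⬝ᵥ bitension τ v s) = 0 := by linarith
      exact (mul_eq_zero.1 this).resolve_left hr0.ne'
    exact dotProduct_self_eq_zero.1 this

end UnitSpeed

/-! ### The Frenet apparatus in components -/

section Frenet

variable {τ : ℝ} {I : Set ℝ} {γ : ℝ → ℂ × ℂ} {s : ℝ}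

lemma IsArcLengthCurve.vel_dotProduct_vel (hτ : τ ≠ 0) (hI : IsOpen I)
    (hγ : IsArcLengthCurve τ I γ) (hs : s ∈ I) : vel τ γ s ⬝ᵥ vel τ γ s = 1 := by
  rw [← metric_ofComp hτ (hγ.mem s hs), ofComp_vel hτ hI hγ.smooth hγ.mem hs]
  exact hγ.unit_speed s hs

lemma k1_eq (hτ : τ ≠ 0) (hI : IsOpen I) (hγ : IsArcLengthCurve τ I γ) (hs : s ∈ I) :
    k1 τ γ s
      = √(cov τ (vel τ γ) (vel τ γ) s ⬝ᵥ cov τ (vel τ γ) (vel τ γ) s) := by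
  rw [k1, tension_eq hτ hI hγ.smooth hγ.mem hs, metric_ofComp hτ (hγ.mem s hs)]

lemma cov_const_smul {v x : ℝ → Fin 3 → ℝ} (r : ℝ) :
    cov τ v (fun u => r • x u) s = r • cov τ v x s := by
  rw [cov, cov, connForm_smul_right, deriv_fun_const_smul_field, smul_add]

variable {c : ℝ}

lemma normal_eq (hτ : τ ≠ 0) (hI : IsOpen I) (hγ : IsArcLengthCurve τ I γ)
    (hk : ∀ s ∈ I, k1 τ γ s = c) (hs : s ∈ I) :
    normal τ γ s = ofComp τ (γ s) (c⁻¹ • cov τ (vel τ γ) (vel τ γ) s) := by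
  rw [normal, hk s hs, tension_eq hτ hI hγ.smooth hγ.mem hs, ofComp_smul]

lemma binormal_eq (hτ : τ ≠ 0) (hI : IsOpen I) (hγ : IsArcLengthCurve τ I γ)
    (hk : ∀ s ∈ I, k1 τ γ s = c) (hs : s ∈ I) :
    binormal τ γ s
      = ofComp τ (γ s) (c⁻¹ • crossProduct (vel τ γ s) (cov τ (vel τ γ) (vel τ γ) s)) := by
  rw [binormal, normal_eq hτ hI hγ hk hs, ← ofComp_vel hτ hI hγ.smooth hγ.mem hs,
    cross_ofComp hτ (hγ.mem s hs), map_smul]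

/-- One factor `c⁻¹` comes from `N` and passes through `∇_T` because it is constant; the other comes
from `B`. -/
lemma k2_eq (hτ : τ ≠ 0) (hI : IsOpen I) (hγ : IsArcLengthCurve τ I γ)
    (hk : ∀ s ∈ I, k1 τ γ s = c) (hs : s ∈ I) :
    k2 τ γ s = (c ^ 2)⁻¹ * torsionNum τ (vel τ γ) s := by
  have hv := contDiffOn_vel (τ := τ) hI hγ.smooth
  rw [k2, covDeriv_ofComp (x := fun u => c⁻¹ • cov τ (vel τ γ) (vel τ γ) u) hτ hI hγ.mem
    ((contDiffOn_cov hI hv hv).const_smul c⁻¹) (fun u hu => normal_eq hτ hI hγ hk hu) hs,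
    binormal_eq hτ hI hγ hk hs, metric_ofComp hτ (hγ.mem s hs), cov_const_smul, torsionNum,
    smul_dotProduct, dotProduct_smul, smul_eq_mul, smul_eq_mul, ← mul_assoc]
  congr 1
  ring

/-- The Frenet characterization of non-geodesic curves with vanishing bitension field. -/
lemma bitension_eq_zero_and_not_isGeodesic_iff (hτ : τ ≠ 0) (hI : IsOpen I)
    (hIc : I.OrdConnected) (hI0 : I.Nonempty) (hγ : IsArcLengthCurve τ I γ) :
    ((∀ s ∈ I, bitension τ (vel τ γ) s = 0) ∧ ¬ IsGeodesic τ I γ) ↔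
      ((∃ c : ℝ, c ≠ 0 ∧ ∀ s ∈ I, k1 τ γ s = c) ∧
        (∀ s ∈ I, k1 τ γ s ^ 2 + k2 τ γ s ^ 2
          = τ ^ 2 - 4 * (1 + τ ^ 2) * comp τ (γ s) (binormal τ γ s) 0 ^ 2) ∧
        (∀ s ∈ I, HasDerivAt (k2 τ γ)
          (-4 * (1 + τ ^ 2) * comp τ (γ s) (normal τ γ s) 0
            * comp τ (γ s) (binormal τ γ s) 0) s)) := by
  have hv := contDiffOn_vel (τ := τ) hI hγ.smooth
  have hunit : ∀ s ∈ I, vel τ γ s ⬝ᵥ vel τ γ s = 1 := fun s hs => hγ.vel_dotProduct_vel hτ hI hs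
  -- For constant `k₁ = c ≠ 0` the equivalence is pointwise: the component equations with `r = c²`
  -- differ from the stated ones by factors `c⁴` and `c²`.
  have key : ∀ c : ℝ, c ≠ 0 → (∀ s ∈ I, k1 τ γ s = c) → ((∀ s ∈ I, bitension τ (vel τ γ) s = 0) ↔
      ((∀ s ∈ I, k1 τ γ s ^ 2 + k2 τ γ s ^ 2
          = τ ^ 2 - 4 * (1 + τ ^ 2) * comp τ (γ s) (binormal τ γ s) 0 ^ 2) ∧
        (∀ s ∈ I, HasDerivAt (k2 τ γ)
          (-4 * (1 + τ ^ 2) * comp τ (γ s) (normal τ γ s) 0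
            * comp τ (γ s) (binormal τ γ s) 0) s))) := by
    intro c hc hk
    have hr : ∀ s ∈ I, cov τ (vel τ γ) (vel τ γ) s ⬝ᵥ cov τ (vel τ γ) (vel τ γ) s = c ^ 2 := by
      intro s hs
      rw [← hk s hs, k1_eq hτ hI hγ hs, Real.sq_sqrt]
      simpa using dotProduct_star_self_nonneg (cov τ (vel τ γ) (vel τ γ) s)
    have hc2 : 0 < c ^ 2 := by positivity
    rw [← forall₂_and]
    refine forall₂_congr fun s hs => ?_
    rw [bitension_eq_zero_iff hτ hI hv hunit hc2 hr hs, hk s hs, k2_eq hτ hI hγ hk hs,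
      normal_eq hτ hI hγ hk hs, binormal_eq hτ hI hγ hk hs, comp_ofComp hτ (hγ.mem s hs),
      comp_ofComp hτ (hγ.mem s hs)]
    simp only [Pi.smul_apply, smul_eq_mul]
    set A := cov τ (vel τ γ) (vel τ γ) s 0
    set B := crossProduct (vel τ γ s) (cov τ (vel τ γ) (vel τ γ) s) 0
    have hk2 : k2 τ γ =ᶠ[nhds s] fun u => (c ^ 2)⁻¹ * torsionNum τ (vel τ γ) u :=
      Filter.eventually_of_mem (hI.mem_nhds hs) fun u hu => k2_eq hτ hI hγ hk hu
    rw [hk2.hasDerivAt_iff]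
    refine and_congr ?_ ⟨fun h => ?_, fun h => ?_⟩
    · set T := torsionNum τ (vel τ γ) s
      constructor <;> intro h
      · field_simp
        linear_combination h
      · field_simp at h
        linear_combination h
    · refine (h.const_mul _).congr_deriv ?_
      field_simp
    · refine ((h.const_mul (c ^ 2)).congr_deriv ?_).congr_of_eventuallyEq (.of_forall fun u => ?_)
      · field_simp
      · field_simp
  constructor
  · rintro ⟨hb, hg⟩
    obtain ⟨r, hr⟩ := exists_cov_dotProduct_cov_eq hI hIc hv hunit hb
    have hk : ∀ s ∈ I, k1 τ γ s = √r := fun s hs => by rw [k1_eq hτ hI hγ hs, hr s hs]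
    have hr0 : √r ≠ 0 := by
      intro h
      refine hg fun s hs => ?_
      have hn : 0 ≤ r := by
        rw [← hr s hs]
        simpa using dotProduct_star_self_nonneg (cov τ (vel τ γ) (vel τ γ) s)
      have h0 := hr s hs
      rw [(Real.sqrt_eq_zero hn).1 h, dotProduct_self_eq_zero] at h0
      rw [tension_eq hτ hI hγ.smooth hγ.mem hs, h0]
      simp [ofComp]
    exact ⟨⟨_, hr0, hk⟩, (key _ hr0 hk).1 hb⟩
  · rintro ⟨⟨c, hc, hk⟩, h⟩
    refine ⟨(key c hc hk).2 h, fun hg => ?_⟩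
    obtain ⟨s, hs⟩ := hI0
    refine hc ?_
    rw [← hk s hs, k1, hg s hs]
    simp [metric, ip]

end Frenet

/-! ### Calculus of two-parameter maps -/

section TwoParameter

variable {F : Type*} [NormedAddCommGroup F] [NormedSpace ℝ F] {U : Set (ℝ × ℝ)} {f : ℝ × ℝ → F}
  {q : ℝ × ℝ}

/-- The partial derivative in the first variable. -/
def dt (f : ℝ × ℝ → F) (q : ℝ × ℝ) : F := fderiv ℝ f q (1, 0)

/-- The partial derivative in the second variable. -/
def ds (f : ℝ × ℝ → F) (q : ℝ × ℝ) : F := fderiv ℝ f q (0, 1)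

lemma contDiffOn_dt (hU : IsOpen U) (hf : ContDiffOn ℝ ∞ f U) : ContDiffOn ℝ ∞ (dt f) U :=
  contDiffOn_fderiv_apply hU hf _

lemma contDiffOn_ds (hU : IsOpen U) (hf : ContDiffOn ℝ ∞ f U) : ContDiffOn ℝ ∞ (ds f) U :=
  contDiffOn_fderiv_apply hU hf _

lemma hasDerivAt_dt (hU : IsOpen U) (hf : ContDiffOn ℝ ∞ f U) (hq : q ∈ U) :
    HasDerivAt (fun r => f (r, q.2)) (dt f q) q.1 := by
  have h : DifferentiableAt ℝ f (q.1, q.2) :=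
    (hf.contDiffAt (hU.mem_nhds hq)).differentiableAt (by simp)
  exact h.hasFDerivAt.comp_hasDerivAt q.1 ((hasDerivAt_id q.1).prodMk (hasDerivAt_const _ _))

lemma hasDerivAt_ds (hU : IsOpen U) (hf : ContDiffOn ℝ ∞ f U) (hq : q ∈ U) :
    HasDerivAt (fun r => f (q.1, r)) (ds f q) q.2 := by
  have h : DifferentiableAt ℝ f (q.1, q.2) :=
    (hf.contDiffAt (hU.mem_nhds hq)).differentiableAt (by simp)
  exact h.hasFDerivAt.comp_hasDerivAt q.2 ((hasDerivAt_const _ _).prodMk (hasDerivAt_id q.2))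

lemma eventually_fst_mem (hU : IsOpen U) (hq : q ∈ U) : ∀ᶠ r in nhds q.1, (r, q.2) ∈ U :=
  ((Continuous.prodMk_left q.2).continuousAt (x := q.1)).eventually_mem (hU.mem_nhds hq)

lemma eventually_snd_mem (hU : IsOpen U) (hq : q ∈ U) : ∀ᶠ r in nhds q.2, (q.1, r) ∈ U :=
  ((Continuous.prodMk_right q.1).continuousAt (x := q.2)).eventually_mem (hU.mem_nhds hq)

lemma dt_ds (hU : IsOpen U) (hf : ContDiffOn ℝ ∞ f U) (hq : q ∈ U) :
    dt (ds f) q = ds (dt f) q := by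
  have hs := (hf.contDiffAt (hU.mem_nhds hq)).isSymmSndFDerivAt
    (by simpa using WithTop.coe_le_coe.2 (le_top : (2 : ℕ∞) ≤ ⊤))
  have hd : DifferentiableAt ℝ (fderiv ℝ f) q :=
    ((hf.fderiv_of_isOpen (m := ∞) hU (by simp)).contDiffAt (hU.mem_nhds hq)).differentiableAt
      (by simp)
  have h (e e' : ℝ × ℝ) :
      fderiv ℝ (fun q => fderiv ℝ f q e) q e' = fderiv ℝ (fderiv ℝ f) q e' e := by
    rw [fderiv_clm_apply hd (differentiableAt_const e)]
    simp
  change fderiv ℝ (fun q => fderiv ℝ f q (0, 1)) q (1, 0)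
    = fderiv ℝ (fun q => fderiv ℝ f q (1, 0)) q (0, 1)
  rw [h, h]
  exact hs _ _

lemma ds_congr {g : ℝ × ℝ → F} (hU : IsOpen U) (h : ∀ q ∈ U, f q = g q) (hq : q ∈ U) :
    ds f q = ds g q := by
  rw [ds, ds, (Filter.eventuallyEq_of_mem (hU.mem_nhds hq) h).fderiv_eq]

end TwoParameter

/-! ### Commuting derivatives along a variation -/

section Variation

variable {τ : ℝ} {U : Set (ℝ × ℝ)} {v w : ℝ × ℝ → Fin 3 → ℝ} {q : ℝ × ℝ}

lemma ds_connForm (hU : IsOpen U) (hv : ContDiffOn ℝ ∞ v U) (hw : ContDiffOn ℝ ∞ w U)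
    (hq : q ∈ U) : ds (fun q => connForm τ (v q) (w q)) q
      = connForm τ (ds v q) (w q) + connForm τ (v q) (ds w q) :=
  (hasDerivAt_ds hU (contDiffOn_connForm hv hw) hq).unique
    (hasDerivAt_connForm (hasDerivAt_ds hU hv hq) (hasDerivAt_ds hU hw hq))

lemma dt_connForm (hU : IsOpen U) (hv : ContDiffOn ℝ ∞ v U) (hw : ContDiffOn ℝ ∞ w U)
    (hq : q ∈ U) : dt (fun q => connForm τ (v q) (w q)) q
      = connForm τ (dt v q) (w q) + connForm τ (v q) (dt w q) :=
  (hasDerivAt_dt hU (contDiffOn_connForm hv hw) hq).unique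
    (hasDerivAt_connForm (hasDerivAt_dt hU hv hq) (hasDerivAt_dt hU hw hq))

lemma ds_add {x y : ℝ × ℝ → Fin 3 → ℝ} (hU : IsOpen U) (hx : ContDiffOn ℝ ∞ x U)
    (hy : ContDiffOn ℝ ∞ y U) (hq : q ∈ U) :
    ds (fun q => x q + y q) q = ds x q + ds y q :=
  (hasDerivAt_ds hU (hx.add hy) hq).unique ((hasDerivAt_ds hU hx hq).add (hasDerivAt_ds hU hy hq))

lemma dt_add {x y : ℝ × ℝ → Fin 3 → ℝ} (hU : IsOpen U) (hx : ContDiffOn ℝ ∞ x U)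
    (hy : ContDiffOn ℝ ∞ y U) (hq : q ∈ U) :
    dt (fun q => x q + y q) q = dt x q + dt y q :=
  (hasDerivAt_dt hU (hx.add hy) hq).unique ((hasDerivAt_dt hU hx hq).add (hasDerivAt_dt hU hy hq))

lemma ds_sub {x y : ℝ × ℝ → Fin 3 → ℝ} (hU : IsOpen U) (hx : ContDiffOn ℝ ∞ x U)
    (hy : ContDiffOn ℝ ∞ y U) (hq : q ∈ U) :
    ds (fun q => x q - y q) q = ds x q - ds y q :=
  (hasDerivAt_ds hU (hx.sub hy) hq).unique ((hasDerivAt_ds hU hx hq).sub (hasDerivAt_ds hU hy hq))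

/-- The covariant derivative in the second variable, in components. -/
def covs (τ : ℝ) (v x : ℝ × ℝ → Fin 3 → ℝ) (q : ℝ × ℝ) : Fin 3 → ℝ :=
  ds x q + connForm τ (v q) (x q)

lemma contDiffOn_covs (hU : IsOpen U) (hv : ContDiffOn ℝ ∞ v U) (hw : ContDiffOn ℝ ∞ w U) :
    ContDiffOn ℝ ∞ (covs τ v w) U :=
  (contDiffOn_ds hU hw).add (contDiffOn_connForm hv hw)

/-- The algebra left over in `dt_covs_self`, with `V`, `W`, `Z` standing for `∂_s v`, `∂_s w`, `∂_s²
w`. -/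
lemma ricci_identity (τ : ℝ) (v w V W Z : Fin 3 → ℝ) :
    Z + (connForm τ V w + connForm τ v W - (connForm τ W v + connForm τ w V))
        + (connForm τ (W + frameBracket τ v w) v + connForm τ v (W + frameBracket τ v w))
      = Z + (connForm τ V w + connForm τ v W) + connForm τ v (W + connForm τ v w)
        + curv τ w v v - connForm τ w (V + connForm τ v v) := by
  ext k
  fin_cases k <;> simp [connForm, frameBracket, curv] <;> ring

/-- Commuting the derivatives of the tension field of a variation. -/
lemma dt_covs_self (hU : IsOpen U) (hv : ContDiffOn ℝ ∞ v U) (hw : ContDiffOn ℝ ∞ w U)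
    (hvw : ∀ q ∈ U, dt v q = ds w q + frameBracket τ (v q) (w q)) (hq : q ∈ U) :
    dt (covs τ v v) q = covs τ v (covs τ v w) q + curv τ (w q) (v q) (v q)
      - connForm τ (w q) (covs τ v v q) := by
  have e1 : dt (covs τ v v) q = dt (ds v) q
      + (connForm τ (dt v q) (v q) + connForm τ (v q) (dt v q)) := by
    rw [← dt_connForm hU hv hv hq]
    exact dt_add hU (contDiffOn_ds hU hv) (contDiffOn_connForm hv hv) hq
  have e2 : dt (ds v) q = ds (ds w) q
      + (connForm τ (ds v q) (w q) + connForm τ (v q) (ds w q)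
        - (connForm τ (ds w q) (v q) + connForm τ (w q) (ds v q))) := by
    rw [dt_ds hU hv hq, ← ds_connForm hU hv hw hq, ← ds_connForm hU hw hv hq,
      ← ds_sub hU (contDiffOn_connForm hv hw) (contDiffOn_connForm hw hv) hq,
      ← ds_add hU (contDiffOn_ds hU hw)
        ((contDiffOn_connForm hv hw).sub (contDiffOn_connForm hw hv)) hq]
    refine ds_congr hU (fun q hq => ?_) hq
    rw [hvw q hq, connForm_sub_connForm]
  have e3 : covs τ v (covs τ v w) q = ds (ds w) q
      + (connForm τ (ds v q) (w q) + connForm τ (v q) (ds w q))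
      + connForm τ (v q) (ds w q + connForm τ (v q) (w q)) := by
    rw [← ds_connForm hU hv hw hq]
    exact congrArg (· + _) (ds_add hU (contDiffOn_ds hU hw) (contDiffOn_connForm hv hw) hq)
  rw [e1, e2, e3, hvw q hq]
  exact ricci_identity τ _ _ _ _ _

/-- The term `connForm τ w` drops out because the connection form is skew. -/
lemma dt_dotProduct_covs (hU : IsOpen U) (hv : ContDiffOn ℝ ∞ v U) (hw : ContDiffOn ℝ ∞ w U)
    (hvw : ∀ q ∈ U, dt v q = ds w q + frameBracket τ (v q) (w q)) (hq : q ∈ U) :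
    dt (fun q => covs τ v v q ⬝ᵥ covs τ v v q) q
      = 2 * (covs τ v v q ⬝ᵥ (covs τ v (covs τ v w) q + curv τ (w q) (v q) (v q))) := by
  have ha := contDiffOn_covs (τ := τ) hU hv hv
  have h : dt (fun q => covs τ v v q ⬝ᵥ covs τ v v q) q
      = dt (covs τ v v) q ⬝ᵥ covs τ v v q + covs τ v v q ⬝ᵥ dt (covs τ v v) q :=
    (hasDerivAt_dt hU (contDiffOn_dotProduct ha ha) hq).unique
      (hasDerivAt_dotProduct (hasDerivAt_dt hU ha hq) (hasDerivAt_dt hU ha hq))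
  have h2 := connForm_dotProduct τ (w q) (covs τ v v q) (covs τ v v q)
  rw [dotProduct_comm (connForm τ (w q) (covs τ v v q))] at h2
  rw [h, dt_covs_self hU hv hw hvw hq, dotProduct_comm _ (covs τ v v q), dotProduct_sub]
  linarith

/-! ### Velocity and variation field of a two-parameter map into the group -/

/-- On `SL2` components become bilinear in `p` and `V`, hence easy to differentiate. -/
lemma comp_eq_mul_ip (hτ : τ ≠ 0) {p : ℂ × ℂ} (hp : p ∈ SL2) (V : ℂ × ℂ) (k : Fin 3) :
    comp τ p V k = ![τ ^ 2, -1, -1] k * ip V (frame τ k p) := by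
  fin_cases k
  · refine (comp_zero_of_mem hτ hp V).trans ?_
    simp [frame, ip, X1]
    field_simp
    ring
  · exact (comp_one_eq τ p V).trans (by simp [frame])
  · exact (comp_two_eq τ p V).trans (by simp [frame])

/-- The left side is what remains of `∂_t v_k - ∂_s w_k` once the mixed second derivatives cancel.
-/
lemma ip_frame_sub_ip_frame (hτ : τ ≠ 0) {p : ℂ × ℂ} (hp : p ∈ SL2) (x y : Fin 3 → ℝ)
    (k : Fin 3) :
    (![τ ^ 2, -1, -1] : Fin 3 → ℝ) k * (ip (ofComp τ p x) (frame τ k (ofComp τ p y))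
      - ip (ofComp τ p y) (frame τ k (ofComp τ p x))) = frameBracket τ x y k := by
  have h := ip_eq_one hp
  rw [ofComp_eq, ofComp_eq]
  fin_cases k
  · simp [frame, ip, X1, X2, X3, frameBracket]
    field_simp
    linear_combination (2 * τ ^ 2 * (x 1 * y 2 - x 2 * y 1)) * h
  · simp [frame, ip, X1, X2, X3, frameBracket]
    field_simp
    linear_combination (-2 * τ * (x 2 * y 0 - x 0 * y 2)) * h
  · simp [frame, ip, X1, X2, X3, frameBracket]
    field_simp
    linear_combination (-2 * τ * (x 0 * y 1 - x 1 * y 0)) * h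

/-- The first structure equation. -/
lemma dt_comp_ds (hτ : τ ≠ 0) {c : ℝ × ℝ → ℂ × ℂ} (hU : IsOpen U) (hc : ContDiffOn ℝ ∞ c U)
    (hmem : ∀ q ∈ U, c q ∈ SL2) (hq : q ∈ U) :
    dt (fun q => comp τ (c q) (ds c q)) q = ds (fun q => comp τ (c q) (dt c q)) q
      + frameBracket τ (comp τ (c q) (ds c q)) (comp τ (c q) (dt c q)) := by
  have hct := hasDerivAt_dt hU hc hq
  have hcs := hasDerivAt_ds hU hc hq
  have hmt : ∀ᶠ r in nhds q.1, c (r, q.2) ∈ SL2 :=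
    (eventually_fst_mem hU hq).mono fun r hr => hmem _ hr
  have hms : ∀ᶠ r in nhds q.2, c (q.1, r) ∈ SL2 :=
    (eventually_snd_mem hU hq).mono fun r hr => hmem _ hr
  have ht : ofComp τ (c q) (comp τ (c q) (dt c q)) = dt c q :=
    ofComp_comp hτ (hmem q hq) (ip_eq_zero_of_hasDerivAt hct hmt)
  have hs : ofComp τ (c q) (comp τ (c q) (ds c q)) = ds c q :=
    ofComp_comp hτ (hmem q hq) (ip_eq_zero_of_hasDerivAt hcs hms)
  funext k
  have h1 := (hasDerivAt_pi.1 (hasDerivAt_dt hU (contDiffOn_comp (τ := τ) hc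
    (contDiffOn_ds hU hc)) hq) k).unique
    (((hasDerivAt_ip (hasDerivAt_dt hU (contDiffOn_ds hU hc) hq)
      (hasDerivAt_frame (τ := τ) (i := k) hct)).const_mul
        ((![τ ^ 2, -1, -1] : Fin 3 → ℝ) k)).congr_of_eventuallyEq
      (hmt.mono fun r hr => comp_eq_mul_ip hτ hr _ k))
  have h2 := (hasDerivAt_pi.1 (hasDerivAt_ds hU (contDiffOn_comp (τ := τ) hc
    (contDiffOn_dt hU hc)) hq) k).unique
    (((hasDerivAt_ip (hasDerivAt_ds hU (contDiffOn_dt hU hc) hq)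
      (hasDerivAt_frame (τ := τ) (i := k) hcs)).const_mul
        ((![τ ^ 2, -1, -1] : Fin 3 → ℝ) k)).congr_of_eventuallyEq
      (hms.mono fun r hr => comp_eq_mul_ip hτ hr _ k))
  have h3 := ip_frame_sub_ip_frame hτ (hmem q hq) (comp τ (c q) (ds c q)) (comp τ (c q) (dt c q)) k
  rw [ht, hs] at h3
  rw [Pi.add_apply, h1, h2, ← h3, dt_ds hU hc hq]
  simp only [Prod.mk.eta]
  ring

end Variation

/-! ### The first variation of the bienergy -/

lemma hasDerivAt_intervalIntegral {I : Set ℝ} {a b ε : ℝ} {f : ℝ × ℝ → ℝ} (hI : IsOpen I)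
    (hab : a ≤ b) (habI : Icc a b ⊆ I) (hε : 0 < ε)
    (hf : ContDiffOn ℝ ∞ f (Ioo (-ε) ε ×ˢ I)) :
    HasDerivAt (fun t => ∫ s in a..b, f (t, s)) (∫ s in a..b, dt f (0, s)) 0 := by
  have hU : IsOpen (Ioo (-ε) ε ×ˢ I) := isOpen_Ioo.prod hI
  have hcont : ∀ {g : ℝ × ℝ → ℝ} {t : ℝ}, ContDiffOn ℝ ∞ g (Ioo (-ε) ε ×ˢ I) → t ∈ Ioo (-ε) ε →
      IntervalIntegrable (fun s => g (t, s)) MeasureTheory.volume a b := by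
    intro g t hg ht
    refine ContinuousOn.intervalIntegrable_of_Icc hab ?_
    exact hg.continuousOn.comp (Continuous.prodMk_right t).continuousOn
      fun s hs => ⟨ht, habI hs⟩
  have h0 : (0 : ℝ) ∈ Ioo (-ε) ε := ⟨by linarith, hε⟩
  -- Halving `ε` gives a compact rectangle, on which `dt f` has a constant dominating bound.
  have hK : Icc (-(ε / 2)) (ε / 2) ×ˢ Icc a b ⊆ Ioo (-ε) ε ×ˢ I :=
    prod_mono (fun t ht => ⟨by linarith [ht.1], by linarith [ht.2]⟩) habI
  obtain ⟨C, hC⟩ := (isCompact_Icc.prod isCompact_Icc).exists_bound_of_continuousOn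
    ((contDiffOn_dt hU hf).continuousOn.mono hK)
  have hu : uIoc a b ⊆ Icc a b := by rw [uIoc_of_le hab]; exact Ioc_subset_Icc_self
  refine (intervalIntegral.hasDerivAt_integral_of_dominated_loc_of_deriv_le
    (F := fun t s => f (t, s)) (F' := fun t s => dt f (t, s)) (bound := fun _ => C)
    (s := Icc (-(ε / 2)) (ε / 2))
    (Icc_mem_nhds (by linarith) (by linarith)) ?_ (hcont hf h0)
    (hcont (contDiffOn_dt hU hf) h0).aestronglyMeasurable_restrict_uIoc
    (.of_forall fun s hs t ht => hC _ ⟨ht, hu hs⟩) intervalIntegrable_const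
    (.of_forall fun s hs t ht => hasDerivAt_dt hU hf (q := (t, s)) (hK ⟨ht, hu hs⟩))).2
  filter_upwards [isOpen_Ioo.mem_nhds h0] with t ht
  exact (hcont hf ht).aestronglyMeasurable_restrict_uIoc

/-! ### Integration by parts and boundary terms -/

section Boundary

variable {τ : ℝ} {I : Set ℝ} {a b : ℝ} {v v' x y w : ℝ → Fin 3 → ℝ} {s : ℝ}

lemma cov_congr (hI : IsOpen I) (hv : ∀ s ∈ I, v s = v' s) (hx : ∀ s ∈ I, x s = y s)
    (hs : s ∈ I) : cov τ v x s = cov τ v' y s := by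
  rw [cov, cov, (Filter.eventuallyEq_of_mem (hI.mem_nhds hs) hx).deriv_eq, hx s hs, hv s hs]

lemma bitension_congr (hI : IsOpen I) (hv : ∀ s ∈ I, v s = v' s) (hs : s ∈ I) :
    bitension τ v s = bitension τ v' s := by
  have h1 : ∀ s ∈ I, cov τ v v s = cov τ v' v' s := fun s hs => cov_congr hI hv hv hs
  have h2 : ∀ s ∈ I, cov τ v (cov τ v v) s = cov τ v' (cov τ v' v') s := fun s hs =>
    cov_congr hI hv h1 hs
  rw [bitension, bitension, cov_congr hI hv h2 hs, h1 s hs, hv s hs]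

lemma contDiffOn_curv (hv : ContDiffOn ℝ ∞ v I) (hx : ContDiffOn ℝ ∞ x I)
    (hy : ContDiffOn ℝ ∞ y I) : ContDiffOn ℝ ∞ (fun s => curv τ (v s) (x s) (y s)) I := by
  refine ((contDiffOn_connForm (τ := τ) hv (contDiffOn_connForm (τ := τ) hx hy)).sub
    (contDiffOn_connForm (τ := τ) hx (contDiffOn_connForm (τ := τ) hv hy))).sub
    (contDiffOn_connForm (τ := τ) ((contDiffOn_connForm (τ := τ) hv hx).sub
      (contDiffOn_connForm (τ := τ) hx hv)) hy) |>.congr fun s _ => ?_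
  -- Torsion-freeness writes the bracket through `connForm`, whose smoothness is known.
  rw [curv, ← connForm_sub_connForm]

lemma contDiffOn_bitension (hI : IsOpen I) (hv : ContDiffOn ℝ ∞ v I) :
    ContDiffOn ℝ ∞ (bitension τ v) I :=
  have ha := contDiffOn_cov (τ := τ) hI hv hv
  (contDiffOn_cov hI hv (contDiffOn_cov hI hv ha)).add (contDiffOn_curv ha hv hv)

/-- Variations are fixed only strictly outside `[a, b]`; the endpoint values are limits from
outside, available since `I` is open. -/
lemma eq_zero_on_Icc_boundary {h : ℝ → ℝ} (hI : IsOpen I) (hab : a < b) (habI : Icc a b ⊆ I)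
    (hh : ContinuousOn h I) (h0 : ∀ s ∈ I, s ∉ Icc a b → h s = 0) : h a = 0 ∧ h b = 0 := by
  have ha : a ∈ I := habI (left_mem_Icc.2 hab.le)
  have hb : b ∈ I := habI (right_mem_Icc.2 hab.le)
  constructor
  · refine tendsto_nhds_unique (f := h) (l := nhdsWithin a (Iio a))
      ((hh.continuousAt (hI.mem_nhds ha)).tendsto.mono_left nhdsWithin_le_nhds)
      (tendsto_const_nhds.congr' ?_)
    filter_upwards [self_mem_nhdsWithin, nhdsWithin_le_nhds (hI.mem_nhds ha)] with s hs hsI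
    exact (h0 s hsI fun hm => absurd hm.1 (not_le.2 hs)).symm
  · refine tendsto_nhds_unique (f := h) (l := nhdsWithin b (Ioi b))
      ((hh.continuousAt (hI.mem_nhds hb)).tendsto.mono_left nhdsWithin_le_nhds)
      (tendsto_const_nhds.congr' ?_)
    filter_upwards [self_mem_nhdsWithin, nhdsWithin_le_nhds (hI.mem_nhds hb)] with s hs hsI
    exact (h0 s hsI fun hm => absurd hm.2 (not_le.2 hs)).symm

/-- Integration by parts in the first variation. -/
lemma integral_cov_eq_integral_bitension (hτ : τ ≠ 0) (hI : IsOpen I) (hab : a < b)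
    (habI : Icc a b ⊆ I) (hv : ContDiffOn ℝ ∞ v I) (hw : ContDiffOn ℝ ∞ w I)
    (hw0 : ∀ s ∈ I, s ∉ Icc a b → w s = 0) :
    ∫ s in a..b, cov τ v v s ⬝ᵥ (cov τ v (cov τ v w) s + curv τ (w s) (v s) (v s))
      = ∫ s in a..b, bitension τ v s ⬝ᵥ w s := by
  have ha := contDiffOn_cov (τ := τ) hI hv hv
  have ha1 := contDiffOn_cov (τ := τ) hI hv ha
  have hw1 := contDiffOn_cov (τ := τ) hI hv hw
  have hw2 := contDiffOn_cov (τ := τ) hI hv hw1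
  have hl := contDiffOn_dotProduct ha (hw2.add (contDiffOn_curv (τ := τ) hw hv hv))
  have hr := contDiffOn_dotProduct (contDiffOn_bitension (τ := τ) hI hv) hw
  have hint : ∀ {g : ℝ → ℝ}, ContDiffOn ℝ ∞ g I →
      IntervalIntegrable g MeasureTheory.volume a b := fun hg =>
    (hg.continuousOn.mono habI).intervalIntegrable_of_Icc hab.le
  have hw1' : ∀ s ∈ I, s ∉ Icc a b → cov τ v w s = 0 := by
    intro s hs hsab
    have : cov τ v w s = cov τ v (fun _ => 0) s :=
      cov_congr (hI.sdiff isClosed_Icc) (fun _ _ => rfl) (fun u hu => hw0 u hu.1 hu.2) ⟨hs, hsab⟩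
    rw [this]
    ext k
    fin_cases k <;> simp [cov, connForm]
  -- Integrating by parts twice leaves the boundary function `⟨a, ∇w⟩ - ⟨∇a, w⟩`; its derivative is
  -- the difference of the two integrands, by the symmetry of the curvature.
  have hH := (contDiffOn_dotProduct ha hw1).sub (contDiffOn_dotProduct ha1 hw)
  obtain ⟨hHa, hHb⟩ := eq_zero_on_Icc_boundary hI hab habI hH.continuousOn fun s hs hsab => by
    simp [hw0 s hs hsab, hw1' s hs hsab]
  have hd : ∀ s ∈ uIcc a b, HasDerivAt
      (fun s => cov τ v v s ⬝ᵥ cov τ v w s - cov τ v (cov τ v v) s ⬝ᵥ w s)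
      (cov τ v v s ⬝ᵥ (cov τ v (cov τ v w) s + curv τ (w s) (v s) (v s))
        - bitension τ v s ⬝ᵥ w s) s := by
    intro s hs
    rw [uIcc_of_le hab.le] at hs
    refine ((hasDerivAt_dotProduct_cov (τ := τ) (v := v) hI ha hw1 (habI hs)).sub
      (hasDerivAt_dotProduct_cov (τ := τ) (v := v) hI ha1 hw (habI hs))).congr_deriv ?_
    have hc := curv_dotProduct hτ (w s) (v s) (cov τ v v s)
    have hc' := curv_dotProduct hτ (cov τ v v s) (v s) (w s)
    rw [dotProduct_comm (crossProduct _ _)] at hc'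
    rw [dotProduct_add, dotProduct_comm _ (curv τ _ _ _), hc, bitension, add_dotProduct, hc']
    ring
  have h := intervalIntegral.integral_eq_sub_of_hasDerivAt hd ((hint hl).sub (hint hr))
  rw [intervalIntegral.integral_sub (hint hl) (hint hr), hHa, hHb] at h
  linarith

end Boundary

lemma covs_eq_cov {τ : ℝ} {U : Set (ℝ × ℝ)} {v x : ℝ × ℝ → Fin 3 → ℝ} {q : ℝ × ℝ} (hU : IsOpen U)
    (hx : ContDiffOn ℝ ∞ x U) (hq : q ∈ U) :
    covs τ v x q = cov τ (fun s => v (q.1, s)) (fun s => x (q.1, s)) q.2 := by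
  rw [cov, (hasDerivAt_ds hU hx hq).deriv, covs]

/-! ### Two-parameter maps restricted to a fixed time -/

section Slices

variable {τ : ℝ} {I : Set ℝ} {ε : ℝ}

lemma contDiffOn_slice {F : Type*} [NormedAddCommGroup F] [NormedSpace ℝ F] {x : ℝ × ℝ → F}
    {t : ℝ} (ht : t ∈ Ioo (-ε) ε) (hx : ContDiffOn ℝ ∞ x (Ioo (-ε) ε ×ˢ I)) :
    ContDiffOn ℝ ∞ (fun s => x (t, s)) I :=
  hx.comp (contDiff_prodMk_right t).contDiffOn fun _ hs => ⟨ht, hs⟩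

lemma vel_slice (hI : IsOpen I) {c : ℝ × ℝ → ℂ × ℂ} (hc : ContDiffOn ℝ ∞ c (Ioo (-ε) ε ×ˢ I))
    {t : ℝ} (ht : t ∈ Ioo (-ε) ε) {s : ℝ} (hs : s ∈ I) :
    vel τ (fun s => c (t, s)) s = comp τ (c (t, s)) (ds c (t, s)) :=
  congrArg (comp τ (c (t, s)))
    (hasDerivAt_ds (isOpen_Ioo.prod hI) hc (q := (t, s)) ⟨ht, hs⟩).deriv

lemma bienergy_slice (hτ : τ ≠ 0) (hI : IsOpen I) {a b : ℝ} (hab : a < b) (habI : Icc a b ⊆ I)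
    {c : ℝ × ℝ → ℂ × ℂ} (hc : ContDiffOn ℝ ∞ c (Ioo (-ε) ε ×ˢ I))
    (hmem : ∀ q ∈ Ioo (-ε) ε ×ˢ I, c q ∈ SL2) {v : ℝ × ℝ → Fin 3 → ℝ}
    (hv : ContDiffOn ℝ ∞ v (Ioo (-ε) ε ×ˢ I))
    (hvel : ∀ q ∈ Ioo (-ε) ε ×ˢ I, comp τ (c q) (ds c q) = v q) {t : ℝ} (ht : t ∈ Ioo (-ε) ε) :
    bienergy τ (fun s => c (t, s)) a b
      = (1 / 2) * ∫ s in a..b, covs τ v v (t, s) ⬝ᵥ covs τ v v (t, s) := by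
  have hmem' : ∀ s ∈ I, c (t, s) ∈ SL2 := fun s hs => hmem (t, s) ⟨ht, hs⟩
  have hvel' : ∀ s ∈ I, vel τ (fun s => c (t, s)) s = v (t, s) := fun s hs =>
    (vel_slice hI hc ht hs).trans (hvel (t, s) ⟨ht, hs⟩)
  rw [bienergy]
  congr 1
  refine intervalIntegral.integral_congr fun s hs => ?_
  rw [uIcc_of_le hab.le] at hs
  have hsI := habI hs
  rw [tension_eq hτ hI (contDiffOn_slice ht hc) hmem' hsI, metric_ofComp hτ (hmem' s hsI),
    cov_congr hI hvel' hvel' hsI, covs_eq_cov (isOpen_Ioo.prod hI) hv ⟨ht, hsI⟩]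

lemma integral_dt_eq_integral_bitension (hτ : τ ≠ 0) (hI : IsOpen I) {a b : ℝ} (hab : a < b)
    (habI : Icc a b ⊆ I) (hε : 0 < ε) {v w : ℝ × ℝ → Fin 3 → ℝ}
    (hv : ContDiffOn ℝ ∞ v (Ioo (-ε) ε ×ˢ I)) (hw : ContDiffOn ℝ ∞ w (Ioo (-ε) ε ×ˢ I))
    (hvw : ∀ q ∈ Ioo (-ε) ε ×ˢ I, dt v q = ds w q + frameBracket τ (v q) (w q))
    (hw0 : ∀ s ∈ I, s ∉ Icc a b → w (0, s) = 0) :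
    (1 / 2) * ∫ s in a..b, dt (fun q => covs τ v v q ⬝ᵥ covs τ v v q) (0, s)
      = ∫ s in a..b, bitension τ (fun s => v (0, s)) s ⬝ᵥ w (0, s) := by
  have hU : IsOpen (Ioo (-ε) ε ×ˢ I) := isOpen_Ioo.prod hI
  have h0 : (0 : ℝ) ∈ Ioo (-ε) ε := ⟨by linarith, hε⟩
  rw [← integral_cov_eq_integral_bitension hτ hI hab habI (contDiffOn_slice h0 hv)
    (contDiffOn_slice h0 hw) hw0, ← intervalIntegral.integral_const_mul]
  refine intervalIntegral.integral_congr fun s hs => ?_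
  rw [uIcc_of_le hab.le] at hs
  have hq : ((0 : ℝ), s) ∈ Ioo (-ε) ε ×ˢ I := ⟨h0, habI hs⟩
  have h1 := dt_dotProduct_covs hU hv hw hvw hq
  have h2 : covs τ v v (0, s) = cov τ (fun s => v (0, s)) (fun s => v (0, s)) s :=
    covs_eq_cov hU hv hq
  have h3 : covs τ v (covs τ v w) (0, s)
      = cov τ (fun s => v (0, s)) (cov τ (fun s => v (0, s)) (fun s => w (0, s))) s :=
    (covs_eq_cov hU (contDiffOn_covs hU hv hw) hq).trans
      (cov_congr hI (fun _ _ => rfl) (fun u hu => covs_eq_cov hU hw ⟨h0, hu⟩) (habI hs))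
  rw [h1, h2, h3]
  ring

end Slices

/-- The first variation formula for the bienergy. -/
lemma IsVariation.hasDerivAt_bienergy {τ : ℝ} (hτ : τ ≠ 0) {I : Set ℝ} (hI : IsOpen I)
    {γ : ℝ → ℂ × ℂ} {a b ε : ℝ} (hab : a < b) (habI : Icc a b ⊆ I) (hε : 0 < ε)
    {Φ : ℝ → ℝ → ℂ × ℂ} (hΦ : IsVariation I γ a b ε Φ) :
    HasDerivAt (fun t => bienergy τ (Φ t) a b)
      (∫ s in a..b, bitension τ (vel τ γ) s ⬝ᵥ comp τ (γ s) (deriv (fun t => Φ t s) 0)) 0 := by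
  have hU : IsOpen (Ioo (-ε) ε ×ˢ I) := isOpen_Ioo.prod hI
  have h0 : (0 : ℝ) ∈ Ioo (-ε) ε := ⟨by linarith, hε⟩
  obtain ⟨c, hcΦ⟩ : ∃ c : ℝ × ℝ → ℂ × ℂ, c = fun q => Φ q.1 q.2 := ⟨_, rfl⟩
  have hcΦ' : ∀ t, Φ t = fun s => c (t, s) := fun t => by rw [hcΦ]
  have hc : ContDiffOn ℝ ∞ c (Ioo (-ε) ε ×ˢ I) := hcΦ ▸ hΦ.smooth
  have hmem : ∀ q ∈ Ioo (-ε) ε ×ˢ I, c q ∈ SL2 := hcΦ ▸ fun q hq => hΦ.mem q.1 hq.1 q.2 hq.2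
  obtain ⟨v, hv_def⟩ : ∃ v, v = fun q => comp τ (c q) (ds c q) := ⟨_, rfl⟩
  obtain ⟨w, hw_def⟩ : ∃ w, w = fun q => comp τ (c q) (dt c q) := ⟨_, rfl⟩
  have hv : ContDiffOn ℝ ∞ v (Ioo (-ε) ε ×ˢ I) := hv_def ▸ contDiffOn_comp hc (contDiffOn_ds hU hc)
  have hw : ContDiffOn ℝ ∞ w (Ioo (-ε) ε ×ˢ I) := hw_def ▸ contDiffOn_comp hc (contDiffOn_dt hU hc)
  have hvw : ∀ q ∈ Ioo (-ε) ε ×ˢ I, dt v q = ds w q + frameBracket τ (v q) (w q) := by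
    rw [hv_def, hw_def]
    exact fun q hq => dt_comp_ds hτ hU hc hmem hq
  have hγv : ∀ s ∈ I, vel τ γ s = v (0, s) := fun s hs => by
    refine Eq.trans ?_ ((vel_slice hI hc h0 hs).trans (congrFun hv_def (0, s)).symm)
    rw [← hcΦ', vel, vel, hΦ.zero s hs,
      (Filter.eventuallyEq_of_mem (hI.mem_nhds hs) hΦ.zero).deriv_eq]
  have hγw : ∀ s ∈ I, comp τ (γ s) (deriv (fun t => Φ t s) 0) = w (0, s) := fun s hs => by
    rw [← hΦ.zero s hs, hw_def]
    simp only [hcΦ']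
    exact congrArg (comp τ (c (0, s))) (hasDerivAt_dt hU hc (q := (0, s)) ⟨h0, hs⟩).deriv
  have hw0 : ∀ s ∈ I, s ∉ Icc a b → w (0, s) = 0 := by
    intro s hs hsab
    have : deriv (fun t => Φ t s) 0 = 0 := by
      rw [(Filter.eventuallyEq_of_mem (isOpen_Ioo.mem_nhds h0)
        fun t ht => hΦ.fixed t ht s hs hsab).deriv_eq, deriv_const]
    rw [← hγw s hs, this]
    ext k
    simp [comp, metric, ip]
  have hen : ∀ t ∈ Ioo (-ε) ε, bienergy τ (Φ t) a b
      = (1 / 2) * ∫ s in a..b, covs τ v v (t, s) ⬝ᵥ covs τ v v (t, s) := fun t ht => by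
    rw [hcΦ']
    exact bienergy_slice hτ hI hab habI hc hmem hv (fun q _ => (congrFun hv_def q).symm) ht
  have hE := (hasDerivAt_intervalIntegral hI hab.le habI hε
    (contDiffOn_dotProduct (contDiffOn_covs (τ := τ) hU hv hv)
      (contDiffOn_covs (τ := τ) hU hv hv))).const_mul (1 / 2 : ℝ)
  refine (hE.congr_deriv ?_).congr_of_eventuallyEq
    (Filter.eventuallyEq_of_mem (isOpen_Ioo.mem_nhds h0) hen)
  rw [integral_dt_eq_integral_bitension hτ hI hab habI hε hv hw hvw hw0]
  refine intervalIntegral.integral_congr fun s hs => ?_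
  rw [uIcc_of_le hab.le] at hs
  have h1 := hγw s (habI hs)
  have h2 := bitension_congr (τ := τ) hI hγv (habI hs)
  exact (congrArg₂ (· ⬝ᵥ ·) h2 h1).symm

/-! ### Biharmonic curves are the curves with vanishing bitension field -/

lemma contDiff_cosh_smul_add_sinh_smul {X : ℂ × ℂ → ℂ × ℂ} (hX : ContDiff ℝ ∞ X) :
    ContDiff ℝ ∞ (fun q : ℝ × (ℂ × ℂ) => Real.cosh q.1 • q.2 + Real.sinh q.1 • X q.2) :=
  ((Real.contDiff_cosh.comp contDiff_fst).smul contDiff_snd).add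
    ((Real.contDiff_sinh.comp contDiff_fst).smul (hX.comp contDiff_snd))

lemma hasDerivAt_cosh_smul_add_sinh_smul (p x : ℂ × ℂ) :
    HasDerivAt (fun θ : ℝ => Real.cosh θ • p + Real.sinh θ • x) x 0 := by
  refine (((Real.hasDerivAt_cosh 0).smul_const p).add
    ((Real.hasDerivAt_sinh 0).smul_const x)).congr_deriv ?_
  simp

/-- Up to scale, each frame field has a smooth flow on `ℂ × ℂ` which preserves `SL(2, ℝ)`. -/
lemma exists_flow_frame {τ : ℝ} (hτ : τ ≠ 0) (k : Fin 3) :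
    ∃ g : ℝ → ℂ × ℂ → ℂ × ℂ, ContDiff ℝ ∞ (fun q : ℝ × (ℂ × ℂ) => g q.1 q.2) ∧
      (∀ θ, ∀ p ∈ SL2, g θ p ∈ SL2) ∧ (∀ p, g 0 p = p) ∧
      ∃ r : ℝ, r ≠ 0 ∧ ∀ p, HasDerivAt (fun θ => g θ p) (r • frame τ k p) 0 := by
  fin_cases k
  -- `X1 ∘ X1 = -1`, so the flow of `X1` is trigonometric; `r = -τ` because `X₁ = -τ E₁`.
  · refine ⟨fun θ p => Real.cos θ • p + Real.sin θ • X1 p, ?_, ?_, by simp, -τ, by simpa, ?_⟩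
    · exact ((Real.contDiff_cos.comp contDiff_fst).smul contDiff_snd).add
        ((Real.contDiff_sin.comp contDiff_fst).smul (contDiff_X1.comp contDiff_snd))
    · intro θ p hp
      have h := ip_eq_one hp
      have h2 := Real.sin_sq_add_cos_sq θ
      simp only [SL2, ip, X1, mem_ofPred_eq, Prod.fst_add, Prod.snd_add, Prod.smul_fst,
        Prod.smul_snd, Complex.add_re, Complex.add_im, Complex.real_smul, Complex.mul_re,
        Complex.mul_im, Complex.I_re, Complex.I_im, Complex.ofReal_re, Complex.ofReal_im]
      linear_combination h2 + (Real.sin θ ^ 2 + Real.cos θ ^ 2) * h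
    · intro p
      refine (((Real.hasDerivAt_cos 0).smul_const p).add
        ((Real.hasDerivAt_sin 0).smul_const (X1 p))).congr_deriv ?_
      simp [frame, smul_smul, hτ]
  -- `X2` and `X3` square to the identity, so their flows are hyperbolic.
  · refine ⟨fun θ p => Real.cosh θ • p + Real.sinh θ • X2 p, ?_, ?_, by simp, 1, by simp, ?_⟩
    · exact contDiff_cosh_smul_add_sinh_smul (contDiff_frame τ 1)
    · intro θ p hp
      have h := ip_eq_one hp
      have h2 := Real.cosh_sq_sub_sinh_sq θ
      simp only [SL2, ip, X2, mem_ofPred_eq, Prod.fst_add, Prod.snd_add, Prod.smul_fst,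
        Prod.smul_snd, Complex.add_re, Complex.add_im, Complex.real_smul, Complex.mul_re,
        Complex.mul_im, Complex.I_re, Complex.I_im, Complex.ofReal_re, Complex.ofReal_im,
        Complex.conj_re, Complex.conj_im]
      linear_combination h2 + (Real.cosh θ ^ 2 - Real.sinh θ ^ 2) * h
    · intro p
      rw [one_smul]
      exact hasDerivAt_cosh_smul_add_sinh_smul p (X2 p)
  · refine ⟨fun θ p => Real.cosh θ • p + Real.sinh θ • X3 p, ?_, ?_, by simp, 1, by simp, ?_⟩
    · exact contDiff_cosh_smul_add_sinh_smul (contDiff_frame τ 2)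
    · intro θ p hp
      have h := ip_eq_one hp
      have h2 := Real.cosh_sq_sub_sinh_sq θ
      simp only [SL2, ip, X3, mem_ofPred_eq, Prod.fst_add, Prod.snd_add, Prod.smul_fst,
        Prod.smul_snd, Complex.add_re, Complex.add_im, Complex.real_smul, Complex.mul_re,
        Complex.mul_im, Complex.ofReal_re, Complex.ofReal_im,
        Complex.conj_re, Complex.conj_im]
      linear_combination h2 + (Real.cosh θ ^ 2 - Real.sinh θ ^ 2) * h
    · intro p
      rw [one_smul]
      exact hasDerivAt_cosh_smul_add_sinh_smul p (X3 p)

section Biharmonic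

variable {τ : ℝ} {I : Set ℝ} {γ : ℝ → ℂ × ℂ}

/-- Flowing `γ s` for time `t * φ s` is an admissible variation with field `r φ E_k`, so the first
variation formula isolates one component. -/
lemma IsBiharmonic.integral_smul_bitension (hτ : τ ≠ 0) (hI : IsOpen I)
    (hγ : IsArcLengthCurve τ I γ) (hb : IsBiharmonic τ I γ) {a b : ℝ} (hab : a < b)
    (habI : Icc a b ⊆ I) (k : Fin 3) {φ : ℝ → ℝ} (hφ : ContDiff ℝ ∞ φ)
    (hsupp : ∀ s ∉ Icc a b, φ s = 0) :
    ∫ s in a..b, φ s • bitension τ (vel τ γ) s k = 0 := by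
  obtain ⟨g, hg, hgmem, hg0, r, hr, hgr⟩ := exists_flow_frame hτ k
  have hΦ : IsVariation I γ a b 1 (fun t s => g (t * φ s) (γ s)) := by
    refine ⟨?_, fun t _ s hs => hgmem _ _ (hγ.mem s hs), fun s _ => by simp [hg0],
      fun t _ s _ hs => by simp [hsupp s hs, hg0]⟩
    exact hg.comp_contDiffOn (((contDiff_fst.mul (hφ.comp contDiff_snd)).contDiffOn).prodMk
      (hγ.smooth.comp contDiff_snd.contDiffOn fun q hq => hq.2))
  have h := (hΦ.hasDerivAt_bienergy hτ hI hab habI one_pos).unique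
    (hb a b hab habI 1 one_pos _ hΦ)
  have hd : ∀ s ∈ I, bitension τ (vel τ γ) s ⬝ᵥ comp τ (γ s) (deriv (fun t => g (t * φ s) (γ s)) 0)
      = r * (φ s • bitension τ (vel τ γ) s k) := by
    intro s hs
    have hmul : HasDerivAt (fun t : ℝ => t * φ s) (φ s) 0 := by
      simpa using (hasDerivAt_id (0 : ℝ)).mul_const (φ s)
    have h0 : HasDerivAt (fun θ => g θ (γ s)) (r • frame τ k (γ s)) (0 * φ s) := by
      rw [zero_mul]; exact hgr _
    have h1 : deriv (fun t => g (t * φ s) (γ s)) 0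
        = ofComp τ (γ s) (Pi.single k (φ s * r)) := by
      refine (HasDerivAt.scomp (0 : ℝ) h0 hmul).deriv.trans ?_
      simp [ofComp, Pi.single_apply, smul_smul]
    rw [h1, comp_ofComp hτ (hγ.mem s hs), dotProduct_single, smul_eq_mul]
    ring
  rw [intervalIntegral.integral_congr fun s hs => hd s (habI (by rwa [uIcc_of_le hab.le] at hs)),
    intervalIntegral.integral_const_mul] at h
  exact (mul_eq_zero.1 h).resolve_left hr

lemma IsBiharmonic.bitension_eq_zero (hτ : τ ≠ 0) (hI : IsOpen I)
    (hγ : IsArcLengthCurve τ I γ) (hb : IsBiharmonic τ I γ) {s : ℝ} (hs : s ∈ I) :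
    bitension τ (vel τ γ) s = 0 := by
  funext k
  -- The closed ball serves as `[a, b]`; test functions are supported in its interior. The
  -- fundamental lemma gives vanishing almost everywhere, and continuity gives it at `s`.
  obtain ⟨δ, hδ, hball⟩ := Metric.nhds_basis_closedBall.mem_iff.1 (hI.mem_nhds hs)
  rw [Real.closedBall_eq_Icc] at hball
  have hsub : Ioo (s - δ) (s + δ) ⊆ Icc (s - δ) (s + δ) := Ioo_subset_Icc_self
  have hcont : ContinuousOn (fun u => bitension τ (vel τ γ) u k) (Ioo (s - δ) (s + δ)) :=
    ((contDiffOn_pi.1 (contDiffOn_bitension hI (contDiffOn_vel hI hγ.smooth)) k).continuousOn.mono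
      (hsub.trans hball))
  have hae := isOpen_Ioo.ae_eq_zero_of_integral_contDiff_smul_eq_zero (μ := MeasureTheory.volume)
    (hcont.locallyIntegrableOn measurableSet_Ioo) fun φ hφ _ hsupp => by
      rw [← hb.integral_smul_bitension hτ hI hγ (by linarith) hball k hφ fun u hu =>
        image_eq_zero_of_notMem_tsupport fun h => hu (hsub (hsupp h))]
      refine (intervalIntegral.integral_eq_integral_of_support_subset ?_).symm
      refine (Function.support_smul_subset_left _ _).trans ((subset_tsupport φ).trans
        (hsupp.trans Ioo_subset_Ioc_self))
  exact MeasureTheory.Measure.eqOn_open_of_ae_eq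
    ((MeasureTheory.ae_restrict_iff' measurableSet_Ioo).2 hae) isOpen_Ioo hcont continuousOn_const
    ⟨by linarith, by linarith⟩

/-- A curve is biharmonic if and only if its bitension field vanishes. -/
lemma isBiharmonic_iff (hτ : τ ≠ 0) (hI : IsOpen I) (hγ : IsArcLengthCurve τ I γ) :
    IsBiharmonic τ I γ ↔ ∀ s ∈ I, bitension τ (vel τ γ) s = 0 := by
  refine ⟨fun hb s hs => hb.bitension_eq_zero hτ hI hγ hs, fun h a b hab habI ε hε Φ hΦ => ?_⟩
  refine (hΦ.hasDerivAt_bienergy hτ hI hab habI hε).congr_deriv ?_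
  refine (intervalIntegral.integral_congr (g := fun _ => (0 : ℝ)) fun s hs => ?_).trans (by simp)
  rw [uIcc_of_le hab.le] at hs
  rw [h s (habI hs), zero_dotProduct]

end Biharmonic

end SLTau

end

theorem mainTheorem2 (τ : ℝ) (hτ : 0 < τ) (I : Set ℝ) (hI_open : IsOpen I)
    (hI_conn : I.OrdConnected) (hI_ne : I.Nonempty) (γ : ℝ → ℂ × ℂ)
    (hγ : SLTau.IsArcLengthCurve τ I γ) :
    SLTau.IsProperBiharmonic τ I γ ↔
      ((∃ c : ℝ, c ≠ 0 ∧ ∀ s ∈ I, SLTau.k1 τ γ s = c) ∧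
        (∀ s ∈ I, SLTau.k1 τ γ s ^ 2 + SLTau.k2 τ γ s ^ 2
          = τ ^ 2 - 4 * (1 + τ ^ 2) * SLTau.comp τ (γ s) (SLTau.binormal τ γ s) 0 ^ 2) ∧
        (∀ s ∈ I, HasDerivAt (SLTau.k2 τ γ)
          (-4 * (1 + τ ^ 2) * SLTau.comp τ (γ s) (SLTau.normal τ γ s) 0
            * SLTau.comp τ (γ s) (SLTau.binormal τ γ s) 0) s)) := by
  rw [SLTau.IsProperBiharmonic, SLTau.isBiharmonic_iff hτ.ne' hI_open hγ]
  exact SLTau.bitension_eq_zero_and_not_isGeodesic_iff hτ.ne' hI_open hI_conn hI_ne hγ
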